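/- Let $K$ be an algebraically closed field, let $n\ge 1$, and let $G$ be $SO_{2n+1}(K)$ (type $B_n$) or $Sp_{2n}(K)$ (type $C_n$), with $T$ the diagonal torus, $B\supset T$ the triangular Borel subgroup and $B^-$ its opposite. Number the simple roots so that $\alpha_1$ is the special node: $\alpha_i=\varepsilon_i-\varepsilon_{i-1}$ for $2\le i\le n$, and $\alpha_1=\varepsilon_1$ in type $B$, $\alpha_1=2\varepsilon_1$ in type $C$. Let $W$ be the Weyl group (the signed permutations of $\{\pm1,\dots,\pm n\}$) with its Bruhat order $\le$, $\omega_r$ the $r$-th fundamental weight, $P_r$ the maximal parabolic subgroup generated by $B$ and representatives of the simple reflections $s_i$, $i\ne r$, and $W^{I_r}=\{w\in W: w(\alpha_i)>0 \text{ for all } i\neq r\}$. For a weight $\lambda$ write $\lambda\ge 0$ if $\lambda$ is a nonnegative real combination of simple roots, and $\lambda\le 0$ if $-\lambda\ge 0$. For $v,w\in W^{I_r}$ let $X_w^v=\overline{BwP_r/P_r}\cap\overline{B^-vP_r/P_r}\subseteq G/P_r$ (Zariski closures). Let $J_{m,[s,t]}$ be the set of tuples $(i_1,\dots,i_m)$ of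 integers in $[s,t]$ with $i_{k+1}-i_k\ge 2$ for all $k$. (i) Let $2\le r\le n-1$. If $n+1-r=2m$ and $\underline i,\underline j\in J_{m,[2,n]}$, let $v_{\underline i},w_{\underline j}\in W^{I_r}$ be the elements with $v_{\underline i}(\omega_r)=\sum_{k=1}^m\alpha_{i_k}$ and $w_{\underline j}(\omega_r)=-\sum_{k=1}^m\alpha_{j_k}$. If $n+1-r=2m+1$ and $\underline i,\underline j\in J_{m,[3,n]}$, let $v_{\underline i},w_{\underline j}\in W^{I_r}$ be the elements with $v_{\underline i}(\omega_r)=c\,\alpha_1+\sum_{k=1}^m\alpha_{i_k}$ and $w_{\underline j}(\omega_r)=-\bigl(c\,\alpha_1+\sum_{k=1}^m\alpha_{j_k}\bigr)$, where $c=1$ in type $B$ and $c=\tfrac12$ in type $C$. In both cases $X^{v_{\underline i}}_{w_{\underline j}}$ is nonempty if and only if $|i_k-j_k|\le 1$ for all $1\le k\le m$; and likewise $v_{\underline i}\le w_{\underline j}$ in the Bruhat order if and only if $|i_k-j_k|\le 1$ for all $1\le k\le m$. (ii) Let $r=1$ or $r=n$. If $v$ is maximal (in the Bruhat order) among the elements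 of $W^{I_r}$ with $v(\omega_r)\ge 0$, and $w$ is minimal among the elements of $W^{I_r}$ with $w(\omega_r)\le 0$, then $X_w^v$ is nonempty and $v\le w$. -/

import Mathlib

open scoped Topology

noncomputable section

namespace RichardsonBC

/-- The two families of root systems `B_n` and `C_n`. -/
inductive DynkinType : Type
  | B : DynkinType
  | C : DynkinType

/-! ### The Weyl group of type `B_n` / `C_n` and its Bruhat order -/

/-- The Weyl group `W` of type `B_n` or `C_n`: the group of signed permutations of `[-n, n]`,
realised as the permutations `σ` of `ℤ` with `σ (-a) = -σ a` that fix all `a` with `|a| > n`.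
The window of `σ` is `(σ 1, …, σ n)`. -/
def weylGroup (n : ℕ) : Subgroup (Equiv.Perm ℤ) where
  carrier := {σ | (∀ a, σ (-a) = -σ a) ∧ ∀ a : ℤ, (n : ℤ) < |a| → σ a = a}
  mul_mem' := by
    rintro σ τ ⟨h1, h2⟩ ⟨h3, h4⟩
    refine ⟨fun a => ?_, fun a ha => ?_⟩
    · simp [Equiv.Perm.mul_apply, h1, h3]
    · simp [Equiv.Perm.mul_apply, h4 a ha, h2 a ha]
  one_mem' := by simp
  inv_mem' := by
    rintro σ ⟨h1, h2⟩
    refine ⟨fun a => ?_, fun a ha => ?_⟩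
    · rw [Equiv.Perm.inv_eq_iff_eq, h1]; simp
    · rw [Equiv.Perm.inv_eq_iff_eq, h2 a ha]

/-- The simple reflections `s_1 = (1, -1)` and `s_i = (i-1, i)(-(i-1), -i)` for `2 ≤ i ≤ n`
(the node `1` is the special node of the Dynkin diagram). -/
def simpleReflection (i : ℕ) : Equiv.Perm ℤ :=
  if i = 1 then Equiv.swap 1 (-1)
  else Equiv.swap ((i : ℤ) - 1) i * Equiv.swap (-((i : ℤ) - 1)) (-(i : ℤ))

/-- The Coxeter length: the least length of a word in `s_1, …, s_n` with product `w`. -/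
def length (n : ℕ) (w : Equiv.Perm ℤ) : ℕ :=
  sInf {k | ∃ l : List ℕ, l.length = k ∧ (∀ i ∈ l, 1 ≤ i ∧ i ≤ n) ∧
    (l.map simpleReflection).prod = w}

/-- The reflections of `W`: the conjugates of the simple reflections. -/
def IsReflection (n : ℕ) (τ : Equiv.Perm ℤ) : Prop :=
  ∃ g ∈ weylGroup n, ∃ i : ℕ, 1 ≤ i ∧ i ≤ n ∧ τ = g * simpleReflection i * g⁻¹

/-- The Bruhat order on `W`: the reflexive-transitive closure of `u → τ u`, for reflections `τ`
with `ℓ(u) < ℓ(τ u)`. -/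
def BruhatLE (n : ℕ) : Equiv.Perm ℤ → Equiv.Perm ℤ → Prop :=
  Relation.ReflTransGen fun u u' =>
    ∃ τ, IsReflection n τ ∧ u' = τ * u ∧ length n u < length n u'

/-! ### Roots and weights

The space `X(T) ⊗ ℝ` is realised inside the functions `x : ℤ → ℝ` as the span of the vectors `ε k`,
`1 ≤ k ≤ n`, where `ε (-k) = -ε k`; a signed permutation `w` maps `ε k` to `ε (w k)`. -/

/-- The coordinate vector `ε k`, with `ε (-k) = -ε k`. -/
def ε (k : ℤ) : ℤ → ℝ := fun a => (if a = k then 1 else 0) - (if a = -k then 1 else 0)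

/-- The action of the Weyl group on weights; `act w (ε k) = ε (w k)`. -/
def act (w : Equiv.Perm ℤ) (x : ℤ → ℝ) : ℤ → ℝ := fun a => x (w⁻¹ a)

/-- The simple roots: `α_i = ε_i - ε_{i-1}` for `2 ≤ i ≤ n`, and `α_1 = ε_1` in type `B`,
`α_1 = 2 ε_1` in type `C`. -/
def simpleRoot (t : DynkinType) (i : ℕ) : ℤ → ℝ :=
  if i = 1 then
    match t with
    | .B => ε 1
    | .C => (2 : ℝ) • ε 1
  else ε i - ε ((i : ℤ) - 1)

/-- The fundamental weights: `ω_r = ε_r + ⋯ + ε_n`, except that `ω_1 = (ε_1 + ⋯ + ε_n) / 2` in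
type `B`. -/
def fundamentalWeight (t : DynkinType) (n r : ℕ) : ℤ → ℝ :=
  match t with
  | .B => (if r = 1 then (1 / 2 : ℝ) else 1) • ∑ k ∈ Finset.Icc r n, ε k
  | .C => ∑ k ∈ Finset.Icc r n, ε k

/-- `x ≥ 0`: `x` is a nonnegative real combination of the simple roots. -/
def Nonneg (t : DynkinType) (n : ℕ) (x : ℤ → ℝ) : Prop :=
  ∃ c : ℕ → ℝ, (∀ i, 0 ≤ c i) ∧ x = ∑ i ∈ Finset.Icc 1 n, c i • simpleRoot t i

/-- The positive roots: the roots (the images of simple roots under `W`) that are `≥ 0`. -/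
def positiveRoots (t : DynkinType) (n : ℕ) : Set (ℤ → ℝ) :=
  {β | (∃ u ∈ weylGroup n, ∃ i : ℕ, 1 ≤ i ∧ i ≤ n ∧ β = act u (simpleRoot t i)) ∧ Nonneg t n β}

/-- `W^{I_r}`, `I_r = {α_r}`: the `w ∈ W` with `w(α_i) > 0` for all simple roots `α_i ≠ α_r`. -/
def minimalReps (t : DynkinType) (n r : ℕ) : Set (Equiv.Perm ℤ) :=
  {w | w ∈ weylGroup n ∧
    ∀ i : ℕ, 1 ≤ i → i ≤ n → i ≠ r → act w (simpleRoot t i) ∈ positiveRoots t n}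

/-- `v` is maximal (for the Bruhat order) among the `v ∈ W^{I_r}` with `v(ω_r) ≥ 0`. -/
def IsMaximalNonneg (t : DynkinType) (n r : ℕ) (v : Equiv.Perm ℤ) : Prop :=
  v ∈ minimalReps t n r ∧ Nonneg t n (act v (fundamentalWeight t n r)) ∧
    ∀ u ∈ minimalReps t n r, Nonneg t n (act u (fundamentalWeight t n r)) →
      BruhatLE n v u → u = v

/-- `w` is minimal (for the Bruhat order) among the `w ∈ W^{I_r}` with `w(ω_r) ≤ 0`. -/
def IsMinimalNonpos (t : DynkinType) (n r : ℕ) (w : Equiv.Perm ℤ) : Prop :=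
  w ∈ minimalReps t n r ∧ Nonneg t n (-act w (fundamentalWeight t n r)) ∧
    ∀ u ∈ minimalReps t n r, Nonneg t n (-act u (fundamentalWeight t n r)) →
      BruhatLE n u w → u = w

/-- `J_{p,[s,t]}`: the tuples `(i_1, …, i_p)` in `[s, t]` with `i_{k+1} - i_k ≥ 2`. -/
def J (p s t : ℕ) : Set (Fin p → ℕ) :=
  {i | (∀ k, s ≤ i k ∧ i k ≤ t) ∧ ∀ k l : Fin p, (l : ℕ) = k + 1 → i k + 2 ≤ i l}

/-- `ε_1` as a multiple of `α_1`: it is `α_1` in type `B` and `α_1 / 2` in type `C`. -/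
def oddPart (t : DynkinType) : ℤ → ℝ :=
  match t with
  | .B => simpleRoot .B 1
  | .C => (1 / 2 : ℝ) • simpleRoot .C 1

/-! ### The algebraic groups and their Richardson varieties -/

/-- The index set of the standard basis of the natural representation: `[-n, n]` in type `B`, and
`[-n, n]` without `0` in type `C`. -/
def Idx (t : DynkinType) (n : ℕ) : Type :=
  {k : ℤ // k ∈ Finset.Icc (-(n : ℤ)) n ∧ (t = .C → k ≠ 0)}

instance (t : DynkinType) (n : ℕ) : CoeOut (Idx t n) ℤ := ⟨Subtype.val⟩

instance (t : DynkinType) (n : ℕ) : DecidableEq (Idx t n) :=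
  inferInstanceAs (DecidableEq {k : ℤ // k ∈ Finset.Icc (-(n : ℤ)) n ∧ (t = .C → k ≠ 0)})

instance (t : DynkinType) (n : ℕ) : Fintype (Idx t n) :=
  Fintype.ofInjective (β := Finset.Icc (-(n : ℤ)) n) (fun a => ⟨a.1, a.2.1⟩)
    (fun _ _ h => Subtype.ext (by simpa using h))

/-- The quadratic form `x_0 ^ 2 + ∑_{k = 1}^n x_k x_{-k}` (used in type `B`). -/
def quadForm {K : Type*} [Field K] {t : DynkinType} {n : ℕ} (x : Idx t n → K) : K :=
  ∑ a : Idx t n, ∑ b : Idx t n, if (a : ℤ) + b = 0 ∧ 0 ≤ (a : ℤ) then x a * x b else 0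

/-- The symplectic form `∑_{k = 1}^n (x_k y_{-k} - x_{-k} y_k)` (used in type `C`). -/
def sympForm {K : Type*} [Field K] {t : DynkinType} {n : ℕ} (x y : Idx t n → K) : K :=
  ∑ a : Idx t n, ∑ b : Idx t n,
    if (a : ℤ) + b = 0 then ((Int.sign (a : ℤ) : ℤ) : K) * (x a * y b) else 0

/-- The defining condition of `SO_{2n+1}` (type `B`) and `Sp_{2n}` (type `C`). -/
def PreservesForm {K : Type*} [Field K] {n : ℕ} :
    (t : DynkinType) → Matrix (Idx t n) (Idx t n) K → Prop
  | .B, g => (∀ x, quadForm (g.mulVec x) = quadForm x) ∧ g.det = 1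
  | .C, g => ∀ x y, sympForm (g.mulVec x) (g.mulVec y) = sympForm x y

/-- The algebraic group `G` (its group of `K`-points): `SO_{2n+1}(K)` in type `B_n` and
`Sp_{2n}(K)` in type `C_n`. -/
def algGroup (K : Type*) [Field K] (t : DynkinType) (n : ℕ) : Subgroup (GL (Idx t n) K) where
  carrier := {g | PreservesForm t (g : Matrix (Idx t n) (Idx t n) K)}
  mul_mem' := by
    intro g h hg hh
    cases t with
    | B =>
      refine ⟨fun x => ?_, ?_⟩
      · rw [Units.val_mul, ← Matrix.mulVec_mulVec, hg.1, hh.1]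
      · rw [Units.val_mul, Matrix.det_mul, hg.2, hh.2, one_mul]
    | C =>
      intro x y
      rw [Units.val_mul, ← Matrix.mulVec_mulVec, ← Matrix.mulVec_mulVec, hg, hh]
  one_mem' := by
    cases t with
    | B => exact ⟨fun x => by simp, by simp⟩
    | C => intro x y; simp
  inv_mem' := by
    intro g hg
    have key : ∀ x, (g : Matrix (Idx t n) (Idx t n) K).mulVec
        ((↑g⁻¹ : Matrix (Idx t n) (Idx t n) K).mulVec x) = x := by
      intro x
      rw [Matrix.mulVec_mulVec, ← Units.val_mul, mul_inv_cancel, Units.val_one,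
        Matrix.one_mulVec]
    cases t with
    | B =>
      refine ⟨fun x => ?_, ?_⟩
      · rw [← hg.1, key]
      · have h1 : (g : Matrix (Idx .B n) (Idx .B n) K).det *
            (↑g⁻¹ : Matrix (Idx .B n) (Idx .B n) K).det = 1 := by
          rw [← Matrix.det_mul, ← Units.val_mul, mul_inv_cancel, Units.val_one, Matrix.det_one]
        rwa [hg.2, one_mul] at h1
    | C =>
      intro x y
      rw [← hg, key, key]

section Group

variable (K : Type*) [Field K] (t : DynkinType) (n : ℕ)

/-- The matrix entry `g_{a b}` of `g ∈ G`. -/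
def entry {K : Type*} [Field K] {t : DynkinType} {n : ℕ} (g : algGroup K t n)
    (a b : Idx t n) : K :=
  (g : GL (Idx t n) K).1 a b

/-- The Borel subgroup `B` for the positive roots: the triangular matrices in `G` whose entries
`g_{a b}` vanish unless `a ≥ b`. (The diagonal torus `T` acts on the `(a, b)` entry of the Lie
algebra with weight `ε_a - ε_b`.) -/
def borel : Set (algGroup K t n) := {g | ∀ a b, entry g a b ≠ 0 → (b : ℤ) ≤ a}

/-- The opposite Borel subgroup `B⁻`. -/
def oppBorel : Set (algGroup K t n) := {g | ∀ a b, entry g a b ≠ 0 → (a : ℤ) ≤ b}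

/-- The representatives in `N_G(T)` of the signed permutation `w`: the monomial matrices in `G`
that map the line of the `b`-th basis vector to that of the `w(b)`-th one. -/
def representatives (w : Equiv.Perm ℤ) : Set (algGroup K t n) :=
  {g | ∀ a b, entry g a b ≠ 0 ↔ (a : ℤ) = w b}

/-- The maximal parabolic subgroup `P_r`, generated by `B` and representatives of the simple
reflections `s_i` with `i ≠ r`. -/
def parabolic (r : ℕ) : Subgroup (algGroup K t n) :=
  Subgroup.closure (borel K t n ∪
    {g | ∃ i : ℕ, 1 ≤ i ∧ i ≤ n ∧ i ≠ r ∧ g ∈ representatives K t n (simpleReflection i)})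

/-- The Zariski topology on `G`: a set is closed if it is the set of common zeros in `G` of some
polynomials in the matrix entries. -/
abbrev zariskiTopology : TopologicalSpace (algGroup K t n) :=
  TopologicalSpace.induced
    (fun g => MvPolynomial.pointToPoint (k := K) (K := K) (fun p : Idx t n × Idx t n => entry g p.1 p.2))
    inferInstance

/-- The Zariski topology on `G / P_r`, which is the quotient topology. -/
abbrev flagTopology (r : ℕ) : TopologicalSpace (algGroup K t n ⧸ parabolic K t n r) :=
  TopologicalSpace.coinduced QuotientGroup.mk (zariskiTopology K t n)

/-- The Schubert variety `X_w`, the closure of `B w P_r / P_r` in `G / P_r`. -/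
def schubertVariety (r : ℕ) (w : Equiv.Perm ℤ) : Set (algGroup K t n ⧸ parabolic K t n r) :=
  closure[flagTopology K t n r]
    {x | ∃ b ∈ borel K t n, ∃ g ∈ representatives K t n w, x = QuotientGroup.mk (b * g)}

/-- The opposite Schubert variety `X^v`, the closure of `B⁻ v P_r / P_r` in `G / P_r`. -/
def oppSchubertVariety (r : ℕ) (v : Equiv.Perm ℤ) :
    Set (algGroup K t n ⧸ parabolic K t n r) :=
  closure[flagTopology K t n r]
    {x | ∃ b ∈ oppBorel K t n, ∃ g ∈ representatives K t n v, x = QuotientGroup.mk (b * g)}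

/-- The Richardson variety `X_w^v` in `G / P_r`, the intersection of `X_w` and `X^v`. -/
def richardsonVariety (r : ℕ) (v w : Equiv.Perm ℤ) :
    Set (algGroup K t n ⧸ parabolic K t n r) :=
  schubertVariety K t n r w ∩ oppSchubertVariety K t n r v

end Group

end RichardsonBC

end

open RichardsonBC

noncomputable section
namespace RichardsonBC

/-! ### Signed permutations, reflections and the exchange property -/

/-! Everything is reduced to a comparison of finite sets of integers. The coset of `w` is determined
by the set `values r n w` of the values of `w` on `[r, n]`, a subset of `[-n, n]` without opposite
pairs. For a minimal representative `v`, three conditions are equivalent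
(`nonempty_and_bruhatLE_iff_galeLE`): `X_w^v` is nonempty; `v ≤ w`; and, for every `c`, the set of
`w` has at most as many elements `≥ c` as the set of `v` (`GaleLE`). They are proved in a cycle.

Nonempty implies Gale: the minors in the columns `≥ r` are Plücker coordinates on `G / P_r`. Those
that do not vanish identically on `X_w` have row sets above the values of `w`, those on `X^v` row
sets below the values of `v`. Every point has a nonzero minor, and its row set lies between the two
(`galeLE_of_richardsonVariety_nonempty`).

Gale implies Bruhat: if the two sets differ, some signed exchange of values raises the smaller set
and keeps it below the larger one (`exists_galeLE_step`). By the strong exchange property this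
exchange shortens `w`, and induction on the length concludes (`bruhatLE_of_galeLE`).

Bruhat implies nonempty: for a step from `u` to `τ u`, a curve in the root subgroup of `τ` shows
that the cell of `u` lies in the closure of the cell of `τ u` (`schubertVariety_subset_of_lt`).
Hence `X_v ⊆ X_w`, and the coset of `v` lies in `X_w^v`.

What remains is counting. In (i), `α_i = ε_i - ε_{i-1}` shows that `v` has the values `i_k`, `-(i_k
- 1)` and, in the odd case, `1`, while `w` has `-j_k`, `j_k - 1` and `-1`. The Gale inequalities
hold term by term if `|i_k - j_k| ≤ 1`, and otherwise fail at `c = j_k - 1` or `c = -j_k`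
(`forall_sum_le_iff`). In (ii), the sums of the coordinates with index `≥ k` are nonnegative on the
positive cone. They turn the signs of the two weights into the Gale inequalities
(`galeLE_of_nonneg_of_nonpos`). -/

/-- The reflection exchanging `a` with `b` and `-a` with `-b`. -/
def signedSwap (a b : ℤ) : Equiv.Perm ℤ :=
  if b = -a then Equiv.swap a b else Equiv.swap a b * Equiv.swap (-a) (-b)

lemma signedSwap_apply {a b : ℤ} (ha : a ≠ 0) (hb : b ≠ 0) (x : ℤ) :
    signedSwap a b x = if x = a then b else if x = b then a else if x = -a then -b
      else if x = -b then -a else x := by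
  unfold signedSwap
  by_cases h : b = -a
  · subst h
    simp only [if_true, Equiv.swap_apply_def]
    split_ifs <;> omega
  · simp only [if_neg h, Equiv.Perm.mul_apply, Equiv.swap_apply_def]
    split_ifs <;> omega

lemma signedSwap_comm {a b : ℤ} (ha : a ≠ 0) (hb : b ≠ 0) : signedSwap a b = signedSwap b a := by
  ext x
  rw [signedSwap_apply ha hb, signedSwap_apply hb ha]
  split_ifs <;> omega

lemma signedSwap_neg {a b : ℤ} (ha : a ≠ 0) (hb : b ≠ 0) :
    signedSwap (-b) (-a) = signedSwap a b := by
  ext x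
  rw [signedSwap_apply ha hb, signedSwap_apply (by omega) (by omega)]
  split_ifs <;> omega

lemma signedSwap_mul_self {a b : ℤ} (ha : a ≠ 0) (hb : b ≠ 0) :
    signedSwap a b * signedSwap a b = 1 := by
  ext x
  rw [Equiv.Perm.mul_apply, signedSwap_apply ha hb (signedSwap a b x), signedSwap_apply ha hb x,
    Equiv.Perm.one_apply]
  split_ifs <;> omega

lemma signedSwap_inv {a b : ℤ} (ha : a ≠ 0) (hb : b ≠ 0) :
    (signedSwap a b)⁻¹ = signedSwap a b :=
  inv_eq_of_mul_eq_one_left (signedSwap_mul_self ha hb)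

lemma mul_signedSwap {g : Equiv.Perm ℤ} (hg : ∀ a, g (-a) = -g a) (a b : ℤ) :
    g * signedSwap a b = signedSwap (g a) (g b) * g := by
  unfold signedSwap
  by_cases h : b = -a
  · rw [if_pos h, if_pos (by rw [h, hg]), Equiv.mul_swap_eq_swap_mul]
  · rw [if_neg h, if_neg (by rw [← hg]; exact fun h' => h (g.injective h')), ← mul_assoc,
      Equiv.mul_swap_eq_swap_mul g, mul_assoc, Equiv.mul_swap_eq_swap_mul g, mul_assoc, hg, hg]

lemma signedSwap_mem {n : ℕ} {a b : ℤ} (ha : a ≠ 0) (hb : b ≠ 0) (ha' : |a| ≤ n) (hb' : |b| ≤ n) :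
    signedSwap a b ∈ weylGroup n := by
  refine ⟨fun x => ?_, fun x hx => ?_⟩
  · rw [signedSwap_apply ha hb, signedSwap_apply ha hb]
    split_ifs <;> omega
  · rw [signedSwap_apply ha hb]
    rw [abs_le] at ha' hb'
    rw [lt_abs] at hx
    split_ifs <;> omega

lemma map_neg_of_mem {n : ℕ} {w : Equiv.Perm ℤ} (hw : w ∈ weylGroup n) (a : ℤ) :
    w (-a) = -w a := hw.1 a

lemma map_zero_of_mem {n : ℕ} {w : Equiv.Perm ℤ} (hw : w ∈ weylGroup n) : w 0 = 0 := by
  have := hw.1 0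
  simp only [neg_zero] at this
  omega

lemma map_ne_zero_of_mem {n : ℕ} {w : Equiv.Perm ℤ} (hw : w ∈ weylGroup n) {a : ℤ} (ha : a ≠ 0) :
    w a ≠ 0 := by
  rw [← map_zero_of_mem hw]
  exact fun h => ha (w.injective h)

lemma abs_map_le_of_mem {n : ℕ} {w : Equiv.Perm ℤ} (hw : w ∈ weylGroup n) {a : ℤ} (ha : |a| ≤ n) :
    |w a| ≤ n := by
  by_contra h
  push Not at h
  have h1 := hw.2 _ h
  rw [w.injective h1] at h
  omega

/-- The smaller one of the two positive or opposite values exchanged by `s_i`. -/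
def lowerEnd (i : ℕ) : ℤ := if i = 1 then -1 else (i : ℤ) - 1

lemma lowerEnd_ne_zero {i : ℕ} : lowerEnd i ≠ 0 := by
  unfold lowerEnd; split_ifs <;> omega

lemma lowerEnd_lt {i : ℕ} (_hi : 1 ≤ i) : lowerEnd i < i := by
  unfold lowerEnd; split_ifs <;> omega

lemma abs_lowerEnd_le {i n : ℕ} (hi : 1 ≤ i) (hin : i ≤ n) : |lowerEnd i| ≤ n := by
  rw [abs_le]; unfold lowerEnd; split_ifs <;> omega

lemma simpleReflection_eq {i : ℕ} : simpleReflection i = signedSwap (lowerEnd i) i := by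
  unfold simpleReflection signedSwap lowerEnd
  by_cases h : i = 1
  · simp [h, Equiv.swap_comm]
  · rw [if_neg h, if_neg h, if_neg (by omega)]

lemma simpleReflection_mem {n i : ℕ} (hi : 1 ≤ i) (hin : i ≤ n) :
    simpleReflection i ∈ weylGroup n := by
  rw [simpleReflection_eq]
  exact signedSwap_mem lowerEnd_ne_zero (by omega) (abs_lowerEnd_le hi hin)
    (by rw [abs_le]; omega)

lemma simpleReflection_mul_self {i : ℕ} (hi : 1 ≤ i) :
    simpleReflection i * simpleReflection i = 1 := by
  rw [simpleReflection_eq]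
  exact signedSwap_mul_self lowerEnd_ne_zero (by omega)

/-- A simple reflection reverses the order of a single pair up to sign. -/
lemma signedSwap_eq_simpleReflection {i : ℕ} (hi : 1 ≤ i) {a b : ℤ} (ha : a ≠ 0) (hb : b ≠ 0)
    (hab : a < b) (h : simpleReflection i b ≤ simpleReflection i a) :
    signedSwap a b = simpleReflection i := by
  have hi0 : (i : ℤ) ≠ 0 := by omega
  have key : (a = lowerEnd i ∧ b = i) ∨ (a = -i ∧ b = -lowerEnd i) := by
    rw [simpleReflection_eq, signedSwap_apply lowerEnd_ne_zero hi0,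
      signedSwap_apply lowerEnd_ne_zero hi0] at h
    unfold lowerEnd at *
    by_cases h1 : i = 1
    · subst h1
      simp only [if_true] at *
      split_ifs at h <;> omega
    · simp only [if_neg h1] at *
      split_ifs at h <;> omega
  rw [simpleReflection_eq]
  rcases key with ⟨rfl, rfl⟩ | ⟨rfl, rfl⟩
  · rfl
  · exact signedSwap_neg lowerEnd_ne_zero hi0

/-! ### Words and the strong exchange property. -/

/-- The words in the simple reflections. -/
def IsWord (n : ℕ) (l : List ℕ) : Prop := ∀ i ∈ l, 1 ≤ i ∧ i ≤ n

lemma isWord_cons {n i : ℕ} {l : List ℕ} :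
    IsWord n (i :: l) ↔ (1 ≤ i ∧ i ≤ n) ∧ IsWord n l := by
  simp [IsWord]

lemma prod_word_mem {n : ℕ} {l : List ℕ} (hl : IsWord n l) :
    (l.map simpleReflection).prod ∈ weylGroup n := by
  refine Subgroup.list_prod_mem _ fun x hx => ?_
  obtain ⟨i, hi, rfl⟩ := List.mem_map.1 hx
  exact simpleReflection_mem (hl i hi).1 (hl i hi).2

/-- The strong exchange property. -/
lemma exists_shorter_word {n : ℕ} (l : List ℕ) (hl : IsWord n l) (a b : ℤ) (ha : a ≠ 0)
    (hb : b ≠ 0) (hab : a < b)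
    (h : (l.map simpleReflection).prod⁻¹ b < (l.map simpleReflection).prod⁻¹ a) :
    ∃ l', IsWord n l' ∧ l'.length < l.length ∧
      (l'.map simpleReflection).prod = signedSwap a b * (l.map simpleReflection).prod := by
  induction l generalizing a b with
  | nil => simp at h; omega
  | cons i l ih =>
    rw [isWord_cons] at hl
    have hs := simpleReflection_mul_self hl.1.1
    have hmem := simpleReflection_mem hl.1.1 hl.1.2
    have hinv : (simpleReflection i)⁻¹ = simpleReflection i := inv_eq_of_mul_eq_one_left hs
    -- If `s_i` keeps the order of the pair, the exchange is conjugated past `s_i` and performed in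
    -- the tail. If it reverses the order, the exchange is `s_i` itself and cancels the first
    -- letter.
    rcases lt_or_ge (simpleReflection i a) (simpleReflection i b) with h1 | h1
    · obtain ⟨l', hl', hlen, hprod⟩ := ih hl.2 _ _ (map_ne_zero_of_mem hmem ha)
        (map_ne_zero_of_mem hmem hb) h1 (by
          simpa [mul_inv_rev, hinv, Equiv.Perm.mul_apply] using h)
      refine ⟨i :: l', isWord_cons.2 ⟨hl.1, hl'⟩, by simpa using hlen, ?_⟩
      rw [List.map_cons, List.prod_cons, hprod, List.map_cons, List.prod_cons, ← mul_assoc,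
        mul_signedSwap hmem.1, ← mul_assoc]
      congr 3
      · rw [← Equiv.Perm.mul_apply, hs, Equiv.Perm.one_apply]
      · rw [← Equiv.Perm.mul_apply, hs, Equiv.Perm.one_apply]
    · refine ⟨l, hl.2, by simp, ?_⟩
      rw [signedSwap_eq_simpleReflection hl.1.1 ha hb hab h1, List.map_cons, List.prod_cons,
        ← mul_assoc, hs, one_mul]

/-- A strictly increasing self-map of an interval of integers is the identity. -/
lemma eq_self_of_lt_of_mem_Icc {f : ℤ → ℤ} {lo hi : ℤ}
    (hmono : ∀ j, lo < j → j ≤ hi → f (j - 1) < f j)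
    (hmem : ∀ j, lo ≤ j → j ≤ hi → lo ≤ f j ∧ f j ≤ hi) (j : ℤ) (h1 : lo ≤ j) (h2 : j ≤ hi) :
    f j = j := by
  have hge : ∀ d : ℕ, lo + d ≤ hi → lo + d ≤ f (lo + d) := by
    intro d
    induction d with
    | zero => intro h; simpa using (hmem lo le_rfl (by simpa using h)).1
    | succ d ih =>
      intro h
      push_cast at h ⊢
      have := hmono (lo + (d + 1)) (by omega) h
      have h3 := ih (by omega)
      rw [show lo + ((d : ℤ) + 1) - 1 = lo + d by ring] at this
      omega
  have hle : ∀ d : ℕ, lo ≤ hi - d → f (hi - d) ≤ hi - d := by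
    intro d
    induction d with
    | zero => intro h; simpa using (hmem hi (by simpa using h) le_rfl).2
    | succ d ih =>
      intro h
      push_cast at h ⊢
      have := hmono (hi - d) (by omega) (by omega)
      have h3 := ih (by omega)
      rw [show hi - (d : ℤ) - 1 = hi - (d + 1) by ring] at this
      omega
  have e1 := hge (j - lo).toNat (by omega)
  have e2 := hle (hi - j).toNat (by omega)
  rw [show lo + ((j - lo).toNat : ℤ) = j by omega] at e1
  rw [show hi - ((hi - j).toNat : ℤ) = j by omega] at e2
  omega

lemma eq_one_of_forall {n : ℕ} {w : Equiv.Perm ℤ} (hw : w ∈ weylGroup n)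
    (h : ∀ j : ℤ, 1 ≤ j → j ≤ n → w j = j) : w = 1 := by
  ext x
  rw [Equiv.Perm.one_apply]
  rcases lt_trichotomy x 0 with hx | rfl | hx
  · by_cases hn : -x ≤ n
    · have := h (-x) (by omega) hn
      rw [map_neg_of_mem hw] at this
      omega
    · exact hw.2 x (by rw [lt_abs]; omega)
  · exact map_zero_of_mem hw
  · by_cases hn : x ≤ n
    · exact h x (by omega) hn
    · exact hw.2 x (by rw [lt_abs]; omega)

/-- The position `i` is an ascent of `w`. -/
def IsAscent (w : Equiv.Perm ℤ) (i : ℕ) : Prop := w (lowerEnd i) < w i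

lemma lt_of_isAscent_ge_two {w : Equiv.Perm ℤ} {n : ℕ} {a : ℕ} (ha : 1 ≤ a)
    (h : ∀ i, a < i → i ≤ n → IsAscent w i) (j : ℤ) (h1 : a < j) (h2 : j ≤ n) :
    w (j - 1) < w j := by
  have := h j.toNat (by omega) (by omega)
  unfold IsAscent lowerEnd at this
  rw [if_neg (by omega), show ((j.toNat : ℕ) : ℤ) = j by omega] at this
  exact this

/-- An ascent at `1` means `w (-1) < w 1`, that is, `w 1 > 0`; the later ascents propagate
positivity. -/
lemma pos_of_isAscent {w : Equiv.Perm ℤ} {n : ℕ} (hw : w ∈ weylGroup n) {m : ℕ}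
    (h : ∀ i, 1 ≤ i → i ≤ m → IsAscent w i) (j : ℤ) (h1 : 1 ≤ j) (h2 : j ≤ m) : 0 < w j := by
  have key : ∀ d : ℕ, (d : ℤ) + 1 ≤ m → 0 < w (d + 1) := by
    intro d
    induction d with
    | zero =>
      intro hd
      have := h 1 le_rfl (by simpa using hd)
      simp only [IsAscent, lowerEnd, if_true, Nat.cast_one, map_neg_of_mem hw] at this
      simp
      omega
    | succ d ih =>
      intro hd
      push_cast at hd ⊢
      have h3 := lt_of_isAscent_ge_two (a := 1) le_rfl (fun i h3 h4 => h i (by omega) h4)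
        ((d : ℤ) + 1 + 1) (by push_cast; omega) hd
      rw [add_sub_cancel_right] at h3
      have := ih (by omega)
      omega
  have := key (j - 1).toNat (by omega)
  rwa [show ((j - 1).toNat : ℤ) + 1 = j by omega] at this

lemma eq_one_of_isAscent {n : ℕ} {w : Equiv.Perm ℤ} (hw : w ∈ weylGroup n)
    (h : ∀ i, 1 ≤ i → i ≤ n → IsAscent w i) : w = 1 := by
  refine eq_one_of_forall hw (eq_self_of_lt_of_mem_Icc ?_ ?_)
  · intro j h1 h2
    exact lt_of_isAscent_ge_two (a := 1) le_rfl (fun i h3 h4 => h i (by omega) h4) j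
      (by push_cast; omega) h2
  · intro j h1 h2
    have h3 := pos_of_isAscent hw h j h1 h2
    have h4 := abs_map_le_of_mem hw (a := j) (by rw [abs_le]; omega)
    rw [abs_le] at h4
    omega

lemma mul_simpleReflection {n : ℕ} {w : Equiv.Perm ℤ} (hw : w ∈ weylGroup n) (i : ℕ) :
    w * simpleReflection i = signedSwap (w (lowerEnd i)) (w i) * w := by
  rw [simpleReflection_eq, mul_signedSwap hw.1]

/-- The potential `∑ j w(j)` of a signed permutation. -/
def potential (n : ℕ) (w : Equiv.Perm ℤ) : ℤ := ∑ j ∈ Finset.Icc 1 n, (j : ℤ) * w j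

/-- Sorting a descent at `i ≥ 2` gives the larger value the larger coefficient, with gain `w (i-1) -
w i`; at `i = 1` it replaces a negative value by its opposite. -/
lemma potential_lt {n : ℕ} {w : Equiv.Perm ℤ} (hw : w ∈ weylGroup n) {i : ℕ} (h1 : 1 ≤ i)
    (h2 : i ≤ n) (h : ¬ IsAscent w i) : potential n w < potential n (w * simpleReflection i) := by
  unfold potential
  rw [← sub_pos, ← Finset.sum_sub_distrib]
  have hne : w (lowerEnd i) ≠ w i := fun h' => (lowerEnd_lt h1).ne (w.injective h')
  unfold IsAscent at h
  by_cases hi : i = 1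
  · subst hi
    rw [Finset.sum_eq_single_of_mem 1 (by simpa using h2)]
    · simp only [lowerEnd, if_true, map_neg_of_mem hw, Equiv.Perm.mul_apply, simpleReflection,
        Nat.cast_one, Equiv.swap_apply_left] at *
      omega
    · intro j hj hj1
      rw [Finset.mem_Icc] at hj
      rw [Equiv.Perm.mul_apply, simpleReflection_eq, signedSwap_apply lowerEnd_ne_zero (by omega)]
      simp only [lowerEnd, if_true]
      split_ifs <;> first | contradiction | omega
  · rw [lowerEnd, if_neg hi] at h hne
    have hsub : ({i - 1, i} : Finset ℕ) ⊆ Finset.Icc 1 n := by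
      intro j hj
      simp only [Finset.mem_insert, Finset.mem_singleton] at hj
      rw [Finset.mem_Icc]; omega
    rw [← Finset.sum_subset hsub, Finset.sum_pair (by omega)]
    · have hc : ((i - 1 : ℕ) : ℤ) = (i : ℤ) - 1 := by omega
      have e1 : simpleReflection i ((i : ℤ) - 1) = i := by
        rw [simpleReflection_eq, signedSwap_apply lowerEnd_ne_zero (by omega), lowerEnd, if_neg hi]
        simp
      have e2 : simpleReflection i (i : ℤ) = (i : ℤ) - 1 := by
        rw [simpleReflection_eq, signedSwap_apply lowerEnd_ne_zero (by omega), lowerEnd, if_neg hi]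
        split_ifs <;> omega
      rw [hc, Equiv.Perm.mul_apply, Equiv.Perm.mul_apply, e1, e2]
      nlinarith [lt_of_le_of_ne (not_lt.1 h) hne.symm]
    · intro j hj hj1
      rw [Finset.mem_Icc] at hj
      simp only [Finset.mem_insert, Finset.mem_singleton, not_or] at hj1
      rw [Equiv.Perm.mul_apply, simpleReflection_eq, signedSwap_apply lowerEnd_ne_zero (by omega)]
      simp only [lowerEnd, if_neg hi]
      split_ifs <;> omega

lemma potential_le {n : ℕ} {w : Equiv.Perm ℤ} (hw : w ∈ weylGroup n) :
    potential n w ≤ ∑ j ∈ Finset.Icc 1 n, (j : ℤ) * n := by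
  refine Finset.sum_le_sum fun j hj => ?_
  rw [Finset.mem_Icc] at hj
  have := abs_map_le_of_mem hw (a := j) (by rw [abs_le]; omega)
  rw [abs_le] at this
  exact mul_le_mul_of_nonneg_left this.2 (by omega)

/-- The simple reflections generate the Weyl group. -/
lemma exists_word {n : ℕ} {w : Equiv.Perm ℤ} (hw : w ∈ weylGroup n) :
    ∃ l, IsWord n l ∧ (l.map simpleReflection).prod = w := by
  -- Induction on the distance of the potential from its upper bound, which shrinks whenever a
  -- descent is sorted.
  obtain ⟨d, hd⟩ : ∃ d : ℕ, ∑ j ∈ Finset.Icc 1 n, (j : ℤ) * n - potential n w ≤ d :=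
    ⟨_, Int.self_le_toNat _⟩
  induction d generalizing w with
  | zero =>
    refine ⟨[], by simp [IsWord], ?_⟩
    refine (eq_one_of_isAscent hw fun i h1 h2 => ?_).symm
    by_contra h
    have e1 := potential_lt hw h1 h2 h
    have e2 := potential_le (mul_mem hw (simpleReflection_mem h1 h2))
    push_cast at hd
    omega
  | succ d ih =>
    by_cases hA : ∀ i, 1 ≤ i → i ≤ n → IsAscent w i
    · exact ⟨[], by simp [IsWord], (eq_one_of_isAscent hw hA).symm⟩
    · push Not at hA
      obtain ⟨i, h1, h2, h⟩ := hA
      have e1 := potential_lt hw h1 h2 h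
      push_cast at hd
      obtain ⟨l, hl, hprod⟩ := ih (mul_mem hw (simpleReflection_mem h1 h2)) (by omega)
      refine ⟨l ++ [i], ?_, ?_⟩
      · intro j hj
        rcases List.mem_append.1 hj with hj | hj
        · exact hl j hj
        · simp only [List.mem_singleton] at hj; subst hj; exact ⟨h1, h2⟩
      · rw [List.map_append, List.prod_append, hprod]
        simp [mul_assoc, simpleReflection_mul_self h1]

/-! ### Length, reflections and steps of the Bruhat order. -/

lemma length_le {n : ℕ} {l : List ℕ} (hl : IsWord n l) :
    length n (l.map simpleReflection).prod ≤ l.length :=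
  Nat.sInf_le ⟨l, rfl, hl, rfl⟩

lemma exists_reduced_word {n : ℕ} {w : Equiv.Perm ℤ} (hw : w ∈ weylGroup n) :
    ∃ l, IsWord n l ∧ (l.map simpleReflection).prod = w ∧ l.length = length n w := by
  obtain ⟨l, hl, hprod⟩ := exists_word hw
  obtain ⟨l', h1, h2, h3⟩ := Nat.sInf_mem (s := {k | ∃ l : List ℕ, l.length = k ∧
    (∀ i ∈ l, 1 ≤ i ∧ i ≤ n) ∧ (l.map simpleReflection).prod = w}) ⟨l.length, l, rfl, hl, hprod⟩
  exact ⟨l', h2, h3, h1⟩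

lemma length_signedSwap_mul_lt {n : ℕ} {u : Equiv.Perm ℤ} (hu : u ∈ weylGroup n) {a b : ℤ}
    (ha : a ≠ 0) (hb : b ≠ 0) (hab : a < b) (h : u⁻¹ b < u⁻¹ a) :
    length n (signedSwap a b * u) < length n u := by
  obtain ⟨l, hl, rfl, hlen⟩ := exists_reduced_word hu
  obtain ⟨l', hl', hlt, hprod⟩ := exists_shorter_word l hl a b ha hb hab h
  rw [← hprod, ← hlen]
  exact (length_le hl').trans_lt hlt

/-- There are two conjugacy classes: `b = -a` is a conjugate of `s_1`, and all other pairs are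
conjugates of `s_2`, by an element carrying `(1, 2)` to `(a, b)`. -/
lemma isReflection_signedSwap {n : ℕ} {a b : ℤ} (ha : a ≠ 0) (hb : b ≠ 0) (ha' : |a| ≤ n)
    (hb' : |b| ≤ n) (hab : a ≠ b) : IsReflection n (signedSwap a b) := by
  have hn : 1 ≤ n := by rw [abs_le] at ha'; omega
  have h1n : |(1 : ℤ)| ≤ n := by rw [abs_le]; omega
  have hg := signedSwap_mem one_ne_zero ha h1n ha'
  have hg1 : signedSwap 1 a 1 = a := by rw [signedSwap_apply one_ne_zero ha]; simp
  by_cases hba : b = -a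
  · refine ⟨signedSwap 1 a, hg, 1, le_rfl, hn, ?_⟩
    rw [mul_simpleReflection hg, mul_inv_cancel_right]
    simp only [lowerEnd, if_true, map_neg_of_mem hg, Nat.cast_one, hg1, hba]
    exact signedSwap_comm ha (by omega)
  -- After `1` has been sent to `a`, the factor `signedSwap 2 b'` sends `2` to `b` and does not
  -- disturb `1`, because `b' ≠ ±1`.
  · set b' := (signedSwap 1 a)⁻¹ b with hb'def
    have hgb : signedSwap 1 a b' = b := by simp [hb'def]
    have hb0 : b' ≠ 0 := map_ne_zero_of_mem (inv_mem hg) hb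
    have hbn : |b'| ≤ n := abs_map_le_of_mem (inv_mem hg) hb'
    have hb1 : b' ≠ 1 := by
      intro h; rw [h, hg1] at hgb; exact hab hgb
    have hb2 : b' ≠ -1 := by
      intro h; rw [h, map_neg_of_mem hg, hg1] at hgb; exact hba hgb.symm
    clear_value b'
    have hn2 : 2 ≤ n := by
      have := abs_le.1 hbn
      omega
    have h2 := signedSwap_mem (n := n) two_ne_zero hb0 (by rw [abs_le]; omega) hbn
    have hm := mul_mem hg h2
    refine ⟨signedSwap 1 a * signedSwap 2 b', hm, 2, by omega, hn2, ?_⟩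
    have e1 : signedSwap 2 b' 1 = 1 := by
      rw [signedSwap_apply two_ne_zero hb0]; split_ifs <;> first | contradiction | omega
    have e2 : signedSwap 2 b' 2 = b' := by
      rw [signedSwap_apply two_ne_zero hb0]; simp
    rw [mul_simpleReflection hm, mul_inv_cancel_right]
    simp [lowerEnd, Equiv.Perm.mul_apply, e1, e2, hg1, hgb]

lemma exists_signedSwap_of_isReflection {n : ℕ} {τ : Equiv.Perm ℤ} (h : IsReflection n τ) :
    ∃ a b : ℤ, a ≠ 0 ∧ b ≠ 0 ∧ |a| ≤ n ∧ |b| ≤ n ∧ a < b ∧ τ = signedSwap a b := by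
  obtain ⟨g, hg, i, h1, h2, rfl⟩ := h
  rw [mul_simpleReflection hg, mul_inv_cancel_right]
  have e1 := map_ne_zero_of_mem hg (lowerEnd_ne_zero (i := i))
  have e2 := map_ne_zero_of_mem hg (a := (i : ℤ)) (by omega)
  have e3 := abs_map_le_of_mem hg (abs_lowerEnd_le h1 h2)
  have e4 := abs_map_le_of_mem hg (a := (i : ℤ)) (by rw [abs_le]; omega)
  rcases lt_trichotomy (g (lowerEnd i)) (g i) with h | h | h
  · exact ⟨_, _, e1, e2, e3, e4, h, rfl⟩
  · exact absurd (g.injective h) (lowerEnd_lt h1).ne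
  · exact ⟨_, _, e2, e1, e4, e3, h, signedSwap_comm e1 e2⟩

/-- The steps of the Bruhat order are the exchanges of values that are in increasing order. -/
lemma exists_of_bruhat_step {n : ℕ} {u τ : Equiv.Perm ℤ} (hu : u ∈ weylGroup n)
    (hτ : IsReflection n τ) (h : length n u < length n (τ * u)) :
    ∃ a b : ℤ, a ≠ 0 ∧ b ≠ 0 ∧ |a| ≤ n ∧ |b| ≤ n ∧ a < b ∧ τ = signedSwap a b ∧
      u⁻¹ a < u⁻¹ b := by
  obtain ⟨a, b, ha, hb, ha', hb', hab, rfl⟩ := exists_signedSwap_of_isReflection hτ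
  refine ⟨a, b, ha, hb, ha', hb', hab, rfl, ?_⟩
  by_contra hlt
  have hne : u⁻¹ a ≠ u⁻¹ b := fun h' => hab.ne (u⁻¹.injective h')
  exact (length_signedSwap_mul_lt hu ha hb hab (lt_of_le_of_ne (not_lt.1 hlt) hne.symm)).not_gt h

lemma bruhatLE_of_signedSwap_mul {n : ℕ} {v w : Equiv.Perm ℤ} (hw : w ∈ weylGroup n) {a b : ℤ}
    (ha : a ≠ 0) (hb : b ≠ 0) (ha' : |a| ≤ n) (hb' : |b| ≤ n) (hab : a < b) (h : w⁻¹ b < w⁻¹ a)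
    (hle : BruhatLE n v (signedSwap a b * w)) : BruhatLE n v w := by
  refine Relation.ReflTransGen.tail hle ⟨signedSwap a b,
    isReflection_signedSwap ha hb ha' hb' hab.ne, ?_, length_signedSwap_mul_lt hw ha hb hab h⟩
  rw [← mul_assoc, signedSwap_mul_self ha hb, one_mul]

/-! ### The Gale order on admissible sets and the Bruhat order on `W^I` -/

/-- The number of elements of `S` that are at least `c`. -/
def upCount (S : Finset ℤ) (c : ℤ) : ℤ := ∑ x ∈ S, if c ≤ x then 1 else 0

/-- Subsets of `[-n, n]` that contain at most one of `a` and `-a`. -/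
def Admissible (n : ℕ) (S : Finset ℤ) : Prop := ∀ x ∈ S, |x| ≤ n ∧ -x ∉ S

/-- The Gale order `T ≤ S`. -/
def GaleLE (T S : Finset ℤ) : Prop := ∀ c, upCount T c ≤ upCount S c

lemma Admissible.ne_zero {n : ℕ} {S : Finset ℤ} (hS : Admissible n S) {x : ℤ} (hx : x ∈ S) :
    x ≠ 0 := by
  rintro rfl
  exact (hS 0 hx).2 (by simpa using hx)

lemma upCount_eq_add (S : Finset ℤ) (c : ℤ) :
    upCount S c = upCount S (c + 1) + if c ∈ S then 1 else 0 := by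
  unfold upCount
  rw [← Finset.sum_ite_eq' S c (fun _ => (1 : ℤ)), ← Finset.sum_add_distrib]
  refine Finset.sum_congr rfl fun x _ => ?_
  split_ifs <;> omega

lemma upCount_of_forall_lt {S : Finset ℤ} {c : ℤ} (h : ∀ x ∈ S, x < c) : upCount S c = 0 :=
  Finset.sum_eq_zero fun x hx => if_neg (not_le.2 (h x hx))

lemma upCount_of_forall_le {S : Finset ℤ} {c : ℤ} (h : ∀ x ∈ S, c ≤ x) :
    upCount S c = S.card := by
  unfold upCount
  rw [Finset.sum_congr rfl fun x hx => if_pos (h x hx)]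
  simp

lemma upCount_image (S : Finset ℤ) (τ : Equiv.Perm ℤ) (c : ℤ) :
    upCount (S.image τ) c = upCount S c +
      ∑ x ∈ S, ((if c ≤ τ x then 1 else 0) - if c ≤ x then 1 else 0) := by
  unfold upCount
  rw [Finset.sum_image (fun x _ y _ h => τ.injective h), ← Finset.sum_add_distrib]
  simp

/-- Here `a` is the only element of `S` that moves: `b` and `-a` are not in `S`, and `-b` is either
absent or equal to `a`. -/
lemma upCount_image_signedSwap {n : ℕ} {S : Finset ℤ} (hS : Admissible n S) {a b : ℤ}
    (ha : a ∈ S) (hb : b ∉ S) (hb0 : b ≠ 0) (h : -b ∉ S ∨ b = -a) (c : ℤ) :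
    upCount (S.image (signedSwap a b)) c =
      upCount S c + ((if c ≤ b then 1 else 0) - if c ≤ a then 1 else 0) := by
  have ha0 := hS.ne_zero ha
  rw [upCount_image, Finset.sum_eq_single_of_mem a ha]
  · simp [signedSwap_apply ha0 hb0]
  · intro x hx hxa
    have e1 : x ≠ b := fun h => hb (h ▸ hx)
    have e2 : x ≠ -a := fun h => (hS a ha).2 (h ▸ hx)
    have e3 : x ≠ -b := by
      rintro rfl
      rcases h with h | h
      · exact h hx
      · omega
    rw [signedSwap_apply ha0 hb0, if_neg hxa, if_neg e1, if_neg e2, if_neg e3, sub_self]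

/-- Two elements move here, `a` to `b` and `-b` to `-a`. -/
lemma upCount_image_signedSwap' {n : ℕ} {S : Finset ℤ} (hS : Admissible n S) {a b : ℤ}
    (ha : a ∈ S) (hb : -b ∈ S) (hab : a ≠ -b) (c : ℤ) :
    upCount (S.image (signedSwap a b)) c =
      upCount S c + ((if c ≤ b then 1 else 0) - (if c ≤ a then 1 else 0) +
        ((if c ≤ -a then 1 else 0) - if c ≤ -b then 1 else 0)) := by
  have ha0 := hS.ne_zero ha
  have hb0 : b ≠ 0 := by have := hS.ne_zero hb; omega
  have hbS : b ∉ S := by simpa using (hS _ hb).2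
  have haS := (hS a ha).2
  have hsub : ({a, -b} : Finset ℤ) ⊆ S := by
    intro x hx
    simp only [Finset.mem_insert, Finset.mem_singleton] at hx
    rcases hx with rfl | rfl
    exacts [ha, hb]
  have e1 : signedSwap a b a = b := by simp [signedSwap_apply ha0 hb0]
  have e2 : signedSwap a b (-b) = -a := by
    have : a ≠ b := fun h => hbS (h ▸ ha)
    rw [signedSwap_apply ha0 hb0]
    split_ifs <;> omega
  rw [upCount_image, ← Finset.sum_subset hsub, Finset.sum_pair hab, e1, e2]
  intro x hx hx1
  simp only [Finset.mem_insert, Finset.mem_singleton, not_or] at hx1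
  have e3 : x ≠ b := fun h => hbS (h ▸ hx)
  have e4 : x ≠ -a := fun h => haS (h ▸ hx)
  rw [signedSwap_apply ha0 hb0, if_neg hx1.1, if_neg e3, if_neg e4, if_neg hx1.2, sub_self]

/-- Two admissible sets in Gale order are joined by a chain of reflections. -/
lemma exists_galeLE_step {n : ℕ} {A C : Finset ℤ} (hA : Admissible n A) (hC : Admissible n C)
    (hcard : A.card = C.card) (hle : GaleLE C A) (hne : A ≠ C) :
    ∃ a b : ℤ, a ∈ C ∧ b ∉ C ∧ a < b ∧ b ≠ 0 ∧ |b| ≤ n ∧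
      GaleLE (C.image (signedSwap a b)) A := by
  have hD : ∀ c, upCount C c ≤ upCount A c := hle
  -- the largest element of the symmetric difference
  obtain ⟨m, hm, hmax⟩ : ∃ m, (m ∈ A ↔ m ∉ C) ∧ ∀ x, m < x → (x ∈ A ↔ x ∈ C) := by
    have hs : (symmDiff A C).Nonempty := by
      rw [Finset.nonempty_iff_ne_empty]
      intro h
      exact hne (symmDiff_eq_bot.1 h)
    refine ⟨(symmDiff A C).max' hs, ?_, fun x hx => ?_⟩
    · have := Finset.max'_mem _ hs
      rw [Finset.mem_symmDiff] at this
      tauto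
    · by_contra hx'
      refine absurd (Finset.le_max' (symmDiff A C) x ?_) (not_le.2 hx)
      rw [Finset.mem_symmDiff]
      tauto
  have hhigh : ∀ c, m < c → upCount A c = upCount C c := by
    intro c hc
    obtain ⟨N, hN⟩ : ∃ N : ℕ, (n : ℤ) < c + N := ⟨((n : ℤ) + 1 - c).toNat, by omega⟩
    induction N generalizing c with
    | zero =>
      rw [upCount_of_forall_lt, upCount_of_forall_lt]
      · intro x hx; have := abs_le.1 (hC x hx).1; push_cast at hN; omega
      · intro x hx; have := abs_le.1 (hA x hx).1; push_cast at hN; omega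
    | succ N ih =>
      rw [upCount_eq_add A, upCount_eq_add C, ih (c + 1) (by omega) (by push_cast at hN; omega)]
      simp only [hmax c hc]
  -- The counts agree above `m`, so `m ∈ C` would put `C` ahead of `A` at `m`. Hence `m` belongs to
  -- `A`.
  have hmD := hD m
  rw [upCount_eq_add A, upCount_eq_add C, hhigh (m + 1) (by omega)] at hmD
  have hmC : m ∉ C := by
    intro h
    have h' : m ∉ A := by tauto
    rw [if_pos h, if_neg h'] at hmD
    omega
  have hmA : m ∈ A := by tauto
  have hm0 := hA.ne_zero hmA
  have hmn := (hA m hmA).1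
  have hmn' := abs_le.1 hmn
  have hDm : upCount A m = upCount C m + 1 := by
    rw [upCount_eq_add A, upCount_eq_add C, hhigh (m + 1) (by omega), if_pos hmA, if_neg hmC]
    omega
  have hlow : ∀ c : ℤ, c ≤ -n → upCount A c = upCount C c := by
    intro c hc
    rw [upCount_of_forall_le, upCount_of_forall_le, hcard]
    · intro x hx; have := abs_le.1 (hC x hx).1; omega
    · intro x hx; have := abs_le.1 (hA x hx).1; omega
  -- the maximal interval `(p, m]` on which the counts differ
  obtain ⟨p, ⟨hp1, hp2⟩, hpmax⟩ := Int.exists_greatest_of_bdd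
    (P := fun p => p ≤ m ∧ upCount A p = upCount C p) ⟨m, fun z hz => hz.1⟩
    ⟨-n, by omega, hlow _ le_rfl⟩
  have hpm : p < m := by
    rcases hp1.lt_or_eq with h | rfl
    · exact h
    · omega
  have hpD : ∀ c, p < c → c ≤ m → upCount C c + 1 ≤ upCount A c := by
    intro c h1 h2
    have h3 := hD c
    by_contra h4
    have := hpmax c ⟨h2, by omega⟩
    omega
  have hpC : p ∈ C := by
    by_contra h
    have h1 := hpD (p + 1) (by omega) (by omega)
    rw [upCount_eq_add A, upCount_eq_add C, if_neg h] at hp2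
    split_ifs at hp2 <;> omega
  -- If `-m ∉ C`, moving `p` to `m` raises the count of `C` by one exactly on `(p, m]`, where `A` is
  -- strictly ahead. Otherwise the reflection would also move `-m` to `-p`, and more care is needed.
  by_cases hnm : -m ∈ C
  swap
  · refine ⟨p, m, hpC, hmC, hpm, hm0, hmn, fun c => ?_⟩
    rw [upCount_image_signedSwap hC hpC hmC hm0 (Or.inl hnm)]
    have h1 := hD c
    have h2 := hpD c
    split_ifs <;> omega
  have hmpos : 0 < m := by
    by_contra h
    exact (hA m hmA).2 ((hmax (-m) (by omega)).2 hnm)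
  -- In this case `(-m, m]` is contained in `(p, m]`, so the sign change `-m ↦ m` is harmless.
  by_cases hpm' : p ≤ -m
  · refine ⟨-m, m, hnm, hmC, by omega, hm0, hmn, fun c => ?_⟩
    rw [upCount_image_signedSwap hC hnm hmC hm0 (Or.inr (by omega))]
    have h1 := hD c
    have h2 := hpD c
    split_ifs <;> omega
  -- the maximal interval `(-m, q]` on which the counts differ
  obtain ⟨q, ⟨hq1, hq2⟩, hqmin⟩ := Int.exists_least_of_bdd
    (P := fun q => -m ≤ q ∧ upCount A (q + 1) = upCount C (q + 1)) ⟨-m, fun z hz => hz.1⟩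
    ⟨p - 1, by omega, by simpa using hp2⟩
  have hqp : q < p := by
    have := hqmin (p - 1) ⟨by omega, by simpa using hp2⟩
    omega
  have hqD : ∀ c, -m < c → c ≤ q → upCount C c + 1 ≤ upCount A c := by
    intro c h1 h2
    have h3 := hD c
    by_contra h4
    have := hqmin (c - 1) ⟨by omega, by rw [sub_add_cancel]; omega⟩
    omega
  have hqm : -m < q := by
    rcases hq1.lt_or_eq with h | rfl
    · exact h
    · have h1 := hD (-m)
      rw [upCount_eq_add A, upCount_eq_add C, if_pos hnm, if_neg (hA m hmA).2, hq2] at h1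
      omega
  have hqAC : q ∈ A ∧ q ∉ C := by
    have h1 := hqD q hqm le_rfl
    rw [upCount_eq_add A, upCount_eq_add C, hq2] at h1
    constructor
    · by_contra h
      rw [if_neg h] at h1
      split_ifs at h1 <;> omega
    · intro h
      rw [if_pos h] at h1
      split_ifs at h1 <;> omega
  have hq0 := hA.ne_zero hqAC.1
  -- Moving `-m` to `q` costs one on `(-m, q]`, where `A` is ahead. If `-q ∈ C`, it also moves `-q`
  -- to `m`, which is affordable when `p ≤ -q`.
  by_cases hnq : -q ∈ C
  · by_cases hpq : p ≤ -q
    · refine ⟨-m, q, hnm, hqAC.2, hqm, hq0, (hA q hqAC.1).1, fun c => ?_⟩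
      rw [upCount_image_signedSwap' hC hnm hnq (by omega)]
      have h1 := hD c
      have h2 := hpD c
      have h3 := hqD c
      split_ifs <;> omega
    -- Now `-p < q`, so moving `p` to `m` and with it `-m` to `-p` raises counts only on `(p, m]`
    -- and inside `(-m, q]`.
    · refine ⟨p, m, hpC, hmC, hpm, hm0, hmn, fun c => ?_⟩
      rw [upCount_image_signedSwap' hC hpC hnm (by omega)]
      have h1 := hD c
      have h2 := hpD c
      have h3 := hqD c
      split_ifs <;> omega
  · refine ⟨-m, q, hnm, hqAC.2, hqm, hq0, (hA q hqAC.1).1, fun c => ?_⟩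
    rw [upCount_image_signedSwap hC hnm hqAC.2 hq0 (Or.inl hnq)]
    have h1 := hD c
    have h3 := hqD c
    split_ifs <;> omega

/-! ### Cosets as sets of values. -/

/-- The set of values of `w` on `[r, n]`, which determines the coset of `w`. -/
def values (r n : ℕ) (w : Equiv.Perm ℤ) : Finset ℤ :=
  (Finset.Icc r n).image fun j : ℕ => w j

lemma mem_values {r n : ℕ} {w : Equiv.Perm ℤ} {x : ℤ} :
    x ∈ values r n w ↔ (r : ℤ) ≤ w⁻¹ x ∧ w⁻¹ x ≤ n := by
  simp only [values, Finset.mem_image, Finset.mem_Icc]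
  constructor
  · rintro ⟨j, hj, rfl⟩
    simpa using hj
  · intro h
    refine ⟨(w⁻¹ x).toNat, by omega, ?_⟩
    rw [Int.toNat_of_nonneg (by omega)]
    simp

lemma sum_values {M : Type*} [AddCommMonoid M] (r n : ℕ) (w : Equiv.Perm ℤ) (g : ℤ → M) :
    ∑ x ∈ values r n w, g x = ∑ j ∈ Finset.Icc r n, g (w j) :=
  Finset.sum_image fun x _ y _ h => by simpa using h

lemma card_values (r n : ℕ) (w : Equiv.Perm ℤ) :
    (values r n w).card = (Finset.Icc r n).card :=
  Finset.card_image_of_injective _ fun x y h => by simpa using h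

lemma admissible_values {r n : ℕ} (hr : 1 ≤ r) {w : Equiv.Perm ℤ} (hw : w ∈ weylGroup n) :
    Admissible n (values r n w) := by
  intro x hx
  rw [mem_values] at hx
  refine ⟨?_, ?_⟩
  · have := abs_map_le_of_mem hw (a := w⁻¹ x) (by rw [abs_le]; omega)
    simpa using this
  · rw [mem_values, map_neg_of_mem (inv_mem hw)]
    omega

lemma values_mul (r n : ℕ) (g w : Equiv.Perm ℤ) :
    values r n (g * w) = (values r n w).image g := by
  unfold values
  rw [Finset.image_image]
  rfl

lemma values_mul_simpleReflection {r n i : ℕ} (hr : 1 ≤ r) (hi : 1 ≤ i) (hin : i ≤ n)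
    (hir : i ≠ r) {w : Equiv.Perm ℤ} :
    values r n (w * simpleReflection i) = values r n w := by
  have hinv : (simpleReflection i)⁻¹ = simpleReflection i :=
    inv_eq_of_mul_eq_one_left (simpleReflection_mul_self hi)
  ext x
  rw [mem_values, mem_values, mul_inv_rev, hinv, Equiv.Perm.mul_apply, simpleReflection_eq,
    signedSwap_apply lowerEnd_ne_zero (by omega)]
  unfold lowerEnd
  split_ifs <;> omega

/-- Elements with the same values on `[r, n]`, both without descents other than `r`, agree. -/
lemma eq_of_values_eq {r n : ℕ} (hr : 1 ≤ r) {v w : Equiv.Perm ℤ}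
    (hv : v ∈ weylGroup n) (hw : w ∈ weylGroup n)
    (hv' : ∀ i, 1 ≤ i → i ≤ n → i ≠ r → IsAscent v i)
    (hw' : ∀ i, 1 ≤ i → i ≤ n → i ≠ r → IsAscent w i)
    (h : values r n v = values r n w) : v = w := by
  have hmem : ∀ j : ℤ, (r : ℤ) ≤ j → j ≤ n → (r : ℤ) ≤ v⁻¹ (w j) ∧ v⁻¹ (w j) ≤ n := by
    intro j h1 h2
    rw [← mem_values, h, mem_values]
    simpa using ⟨h1, h2⟩
  have hmem' : ∀ j : ℤ, (r : ℤ) ≤ v⁻¹ (w j) → v⁻¹ (w j) ≤ n → (r : ℤ) ≤ j ∧ j ≤ n := by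
    intro j h1 h2
    have := mem_values.2 ⟨h1, h2⟩
    rw [h, mem_values] at this
    simpa using this
  -- On an interval of positions where `v` has only ascents, `v` also reflects the order.
  have hvm : ∀ (a : ℕ) (b : ℕ), 1 ≤ a → b ≤ n → (∀ i, a < i → i ≤ b → i ≠ r) →
      ∀ x y : ℤ, (a : ℤ) ≤ x → x ≤ b → (a : ℤ) ≤ y → y ≤ b → v x < v y → x < y := by
    intro a b ha hb hne x y hx1 hx2 hy1 hy2 hlt
    by_contra hxy
    have hmono : ∀ d : ℕ, y + d ≤ b → v y ≤ v (y + d) := by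
      intro d
      induction d with
      | zero => intro _; simp
      | succ d ih =>
        intro hd
        push_cast at hd ⊢
        have e := lt_of_isAscent_ge_two (w := v) (n := b) ha
          (fun i h1 h2 => hv' i (by omega) (by omega) (hne i h1 h2)) (y + (d + 1))
          (by omega) hd
        rw [show y + ((d : ℤ) + 1) - 1 = y + d by ring] at e
        have := ih (by omega)
        omega
    have := hmono (x - y).toNat (by omega)
    rw [show y + ((x - y).toNat : ℤ) = x by omega] at this
    omega
  -- The permutation `v⁻¹ w` preserves the blocks `[r, n]` and `[1, r-1]` and is increasing on each
  -- of them.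
  suffices hone : v⁻¹ * w = 1 by
    rw [inv_mul_eq_one] at hone
    exact hone
  have hx := mul_mem (inv_mem hv) hw
  refine eq_one_of_forall hx fun j h1 h2 => ?_
  rw [Equiv.Perm.mul_apply]
  by_cases hjr : (r : ℤ) ≤ j
  · refine eq_self_of_lt_of_mem_Icc (f := fun j => v⁻¹ (w j)) (lo := r) (hi := n) ?_ hmem j hjr h2
    intro i hi1 hi2
    have e1 := hmem i (by omega) hi2
    have e2 := hmem (i - 1) (by omega) (by omega)
    refine hvm r n hr le_rfl (fun i h1 _ => by omega) _ _ e2.1 e2.2 e1.1 e1.2 ?_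
    simpa using lt_of_isAscent_ge_two hr (fun i h1 h2 => hw' i (by omega) h2 (by omega)) i hi1 hi2
  -- Equality of the value sets fixes the lower block only up to signs; positivity of `v` and `w`
  -- there removes the signs. The bound `min (r - 1) n` covers `r > n`.
  · have hvpos : ∀ j : ℤ, 1 ≤ j → j ≤ (r - 1 : ℕ) → j ≤ n → 0 < v j := fun j h1 h2 h3 =>
      pos_of_isAscent hv (m := min (r - 1) n) (fun i h1 h2 => hv' i h1 (by omega) (by omega)) j h1
        (by omega)
    have hwpos : ∀ j : ℤ, 1 ≤ j → j ≤ (r - 1 : ℕ) → j ≤ n → 0 < w j := fun j h1 h2 h3 =>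
      pos_of_isAscent hw (m := min (r - 1) n) (fun i h1 h2 => hw' i h1 (by omega) (by omega)) j h1
        (by omega)
    have hmem2 : ∀ j : ℤ, 1 ≤ j → j ≤ (min (r - 1) n : ℕ) →
        1 ≤ v⁻¹ (w j) ∧ v⁻¹ (w j) ≤ (min (r - 1) n : ℕ) := by
      intro j h1 h2
      have e1 := hmem' j
      have e2 := hmem' (-j)
      have e3 := abs_le.1 (abs_map_le_of_mem hx (a := j) (by rw [abs_le]; omega))
      rw [Equiv.Perm.mul_apply] at e3
      rw [map_neg_of_mem hw, map_neg_of_mem (inv_mem hv)] at e2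
      have e4 : v⁻¹ (w j) ≠ 0 :=
        map_ne_zero_of_mem (inv_mem hv) (map_ne_zero_of_mem hw (by omega))
      have e5 := hwpos j h1 (by omega) (by omega)
      have e6 := hvpos (-v⁻¹ (w j))
      rw [map_neg_of_mem hv, show v (v⁻¹ (w j)) = w j by simp] at e6
      omega
    refine eq_self_of_lt_of_mem_Icc (f := fun j => v⁻¹ (w j)) (lo := 1)
      (hi := (min (r - 1) n : ℕ)) ?_ hmem2 j h1 (by omega)
    intro i hi1 hi2
    have e1 := hmem2 i (by omega) hi2
    have e2 := hmem2 (i - 1) (by omega) (by omega)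
    refine hvm 1 (min (r - 1) n) le_rfl (by omega) (fun i h1 _ => by omega) _ _
      (by simpa using e2.1) e2.2 (by simpa using e1.1) e1.2 ?_
    simpa using lt_of_isAscent_ge_two (w := w) (a := 1) (n := min (r - 1) n) le_rfl
      (fun i h1 h2 => hw' i (by omega) (by omega) (by omega)) i (by simpa using hi1) hi2

/-- If the sets of values are in Gale order, then the elements are in Bruhat order, provided that
the smaller one is a minimal coset representative. -/
theorem bruhatLE_of_galeLE {r n : ℕ} (hr : 1 ≤ r) {v w : Equiv.Perm ℤ}
    (hv : v ∈ weylGroup n) (hw : w ∈ weylGroup n)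
    (hv' : ∀ i, 1 ≤ i → i ≤ n → i ≠ r → IsAscent v i)
    (h : GaleLE (values r n w) (values r n v)) : BruhatLE n v w := by
  induction hN : length n w using Nat.strong_induction_on generalizing w with
  | _ N ih =>
    subst hN
    -- If `w` has a descent at some `i ≠ r`, then `w s_i` is shorter with the same set of values;
    -- otherwise a Gale step shortens `w`.
    by_cases hw' : ∀ i, 1 ≤ i → i ≤ n → i ≠ r → IsAscent w i
    · by_cases heq : values r n v = values r n w
      · rw [eq_of_values_eq hr hv hw hv' hw' heq]
        exact Relation.ReflTransGen.refl
      · obtain ⟨a, b, ha, hb, hab, hb0, hbn, hle⟩ := exists_galeLE_step (admissible_values hr hv)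
          (admissible_values hr hw) (by rw [card_values, card_values]) h heq
        have ha0 := (admissible_values hr hw).ne_zero ha
        have han := (admissible_values hr hw a ha).1
        -- The position of `a` is in `[r, n]`; that of `b` is in `[-n, n]` but not in `[r, n]`,
        -- hence below `r`.
        have hinv : w⁻¹ b < w⁻¹ a := by
          have := abs_le.1 (abs_map_le_of_mem (inv_mem hw) hbn)
          rw [mem_values] at ha hb
          omega
        refine bruhatLE_of_signedSwap_mul hw ha0 hb0 han hbn hab hinv ?_
        refine ih _ (length_signedSwap_mul_lt hw ha0 hb0 hab hinv)
          (mul_mem (signedSwap_mem ha0 hb0 han hbn) hw) ?_ rfl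
        rwa [values_mul]
    · push Not at hw'
      obtain ⟨i, h1, h2, h3, h4⟩ := hw'
      have e1 := map_ne_zero_of_mem hw (lowerEnd_ne_zero (i := i))
      have e2 := map_ne_zero_of_mem hw (a := (i : ℤ)) (by omega)
      have e3 := abs_map_le_of_mem hw (abs_lowerEnd_le h1 h2)
      have e4 := abs_map_le_of_mem hw (a := (i : ℤ)) (by rw [abs_le]; omega)
      have hne : w (lowerEnd i) ≠ w i := fun h' => (lowerEnd_lt h1).ne (w.injective h')
      unfold IsAscent at h4
      have hlt : w i < w (lowerEnd i) := lt_of_le_of_ne (not_lt.1 h4) hne.symm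
      have hinv : w⁻¹ (w (lowerEnd i)) < w⁻¹ (w i) := by simpa using lowerEnd_lt h1
      have hmul := mul_simpleReflection hw i
      rw [signedSwap_comm e1 e2] at hmul
      refine bruhatLE_of_signedSwap_mul hw e2 e1 e4 e3 hlt hinv ?_
      refine ih _ (length_signedSwap_mul_lt hw e2 e1 hlt hinv) ?_ ?_ rfl
      · exact mul_mem (signedSwap_mem e2 e1 e4 e3) hw
      · rw [← hmul, values_mul_simpleReflection hr h1 h2 h3]
        exact h

/-! ### Minors on Schubert varieties -/

variable {K : Type*} [Field K] {t : DynkinType} {n : ℕ}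

lemma entry_mul (g h : algGroup K t n) (a b : Idx t n) :
    entry (g * h) a b = ∑ c, entry g a c * entry h c b := rfl

lemma entry_one (a b : Idx t n) : entry (1 : algGroup K t n) a b = if a = b then 1 else 0 := rfl

/-- The Zariski closed subsets of `G` are the zero sets of polynomials in the entries. -/
lemma isClosed_zariski_iff {Z : Set (algGroup K t n)} :
    IsClosed[zariskiTopology K t n] Z ↔ ∃ S : Set (MvPolynomial (Idx t n × Idx t n) K),
      Z = {g | ∀ F ∈ S, MvPolynomial.eval (fun p => entry g p.1 p.2) F = 0} := by
  have key : ∀ (S : Set (MvPolynomial (Idx t n × Idx t n) K)) (g : algGroup K t n),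
      MvPolynomial.pointToPoint (k := K) (K := K) (fun p : Idx t n × Idx t n => entry g p.1 p.2) ∈
        PrimeSpectrum.zeroLocus S ↔
      ∀ F ∈ S, MvPolynomial.eval (fun p => entry g p.1 p.2) F = 0 := by
    intro S g
    rw [PrimeSpectrum.mem_zeroLocus]
    refine forall₂_congr fun F _ => ?_
    exact MvPolynomial.mem_vanishingIdeal_singleton_iff _ _
  rw [isClosed_induced_iff]
  constructor
  · rintro ⟨Y, hY, rfl⟩
    obtain ⟨S, rfl⟩ := (PrimeSpectrum.isClosed_iff_zeroLocus _).1 hY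
    exact ⟨S, Set.ext fun g => key S g⟩
  · rintro ⟨S, rfl⟩
    exact ⟨_, PrimeSpectrum.isClosed_zeroLocus S, Set.ext fun g => key S g⟩

/-- The indices at least `r`, which span the subspace stabilised by `P_r`. -/
abbrev UpperIdx (t : DynkinType) (n r : ℕ) : Type := {a : Idx t n // (r : ℤ) ≤ a}

lemma sum_upperIdx {M : Type*} [AddCommMonoid M] {r : ℕ} (hr : 1 ≤ r) (g : ℤ → M) :
    ∑ i : UpperIdx t n r, g (i : Idx t n) = ∑ j ∈ Finset.Icc r n, g j := by
  refine Finset.sum_bij (fun i _ => ((i : Idx t n) : ℤ).toNat) ?_ ?_ ?_ ?_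
  · intro i _
    have h1 := i.2
    have h2 := Finset.mem_Icc.1 i.1.2.1
    rw [Finset.mem_Icc]
    omega
  · intro i _ j _ h
    have h1 := i.2
    have h2 := j.2
    exact Subtype.ext (Subtype.ext (by omega))
  · intro j hj
    rw [Finset.mem_Icc] at hj
    exact ⟨⟨⟨(j : ℤ), by rw [Finset.mem_Icc]; omega, fun _ => by omega⟩, by simpa using hj.1⟩,
      Finset.mem_univ _, by simp⟩
  · intro i _
    have h1 := i.2
    congr 1
    omega

/-- The span of the basis vectors with index `≥ r` is stable under `B`, which only raises indices,
and under `s_i` for `i ≠ r`, which does not exchange indices across `r`. -/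
lemma parabolic_entry_eq_zero {r : ℕ} (hr : 1 ≤ r) {p : algGroup K t n}
    (hp : p ∈ parabolic K t n r) (a b : Idx t n) (ha : (a : ℤ) < r) (hb : (r : ℤ) ≤ b) :
    entry p a b = 0 := by
  induction hp using Subgroup.closure_induction generalizing a b with
  | mem x hx =>
    by_contra h
    rcases hx with hx | ⟨i, h1, h2, h3, hx⟩
    · have := hx a b h
      omega
    · have := (hx a b).1 h
      rw [simpleReflection_eq, signedSwap_apply lowerEnd_ne_zero (by omega)] at this
      unfold lowerEnd at this
      split_ifs at this <;> omega
  | one =>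
    rw [entry_one, if_neg]
    rintro rfl
    omega
  | mul x y _ _ hx hy =>
    rw [entry_mul]
    refine Finset.sum_eq_zero fun c _ => ?_
    rcases lt_or_ge (c : ℤ) r with hc | hc
    · rw [hy c b hc hb, mul_zero]
    · rw [hx a c ha hc, zero_mul]
  | inv x _ hx =>
    let f : Idx t n → ℕ := fun c => if (r : ℤ) ≤ c then 0 else 1
    have hblock : (x : GL (Idx t n) K).1.BlockTriangular f := by
      intro c d hcd
      refine hx c d ?_ ?_ <;> simp only [f] at hcd <;> split_ifs at hcd <;> omega
    have : Invertible (x : GL (Idx t n) K).1 := (x : GL (Idx t n) K).invertible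
    have := Matrix.blockTriangular_inv_of_blockTriangular hblock
    have h2 := @this a b (by simp only [f]; rw [if_pos hb, if_neg (by omega)]; exact one_pos)
    rw [← Matrix.coe_units_inv] at h2
    exact h2

/-- The minor of `g` with the rows `f` and the columns at least `r`. -/
def minor {r : ℕ} (f : UpperIdx t n r → Idx t n) (g : algGroup K t n) : K :=
  (Matrix.of fun i j : UpperIdx t n r => entry g (f i) j).det

/-- Right multiplication by `P_r` scales all these minors by one common factor, so their vanishing
is a condition on the coset. -/
lemma minor_mul {r : ℕ} (hr : 1 ≤ r) (f : UpperIdx t n r → Idx t n) (g : algGroup K t n)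
    {p : algGroup K t n} (hp : p ∈ parabolic K t n r) :
    minor f (g * p) = minor f g *
      (Matrix.of fun i j : UpperIdx t n r => entry p i j).det := by
  unfold minor
  rw [← Matrix.det_mul]
  congr 1
  ext i j
  rw [Matrix.mul_apply, Matrix.of_apply, entry_mul,
    ← Fintype.sum_subtype_add_sum_subtype (fun a : Idx t n => (r : ℤ) ≤ a)]
  simp only [Matrix.of_apply]
  rw [add_eq_left]
  refine Finset.sum_eq_zero fun c _ => ?_
  rw [parabolic_entry_eq_zero hr hp _ _ (not_le.1 c.2) j.2, mul_zero]

lemma minor_eq_zero_of_mk_eq {r : ℕ} (hr : 1 ≤ r) (f : UpperIdx t n r → Idx t n)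
    {g g' : algGroup K t n}
    (h : (QuotientGroup.mk g : algGroup K t n ⧸ parabolic K t n r) = QuotientGroup.mk g')
    (hg : minor f g = 0) : minor f g' = 0 := by
  rw [← mul_inv_cancel_left g g', minor_mul hr f g (QuotientGroup.eq.1 h), hg, zero_mul]

lemma isClosed_minor_eq_zero {r : ℕ} (f : UpperIdx t n r → Idx t n) :
    IsClosed[zariskiTopology K t n] {g : algGroup K t n | minor f g = 0} := by
  rw [isClosed_zariski_iff]
  refine ⟨{(Matrix.of fun i j : UpperIdx t n r =>
    (MvPolynomial.X (f i, (j : Idx t n)) : MvPolynomial (Idx t n × Idx t n) K)).det}, ?_⟩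
  ext g
  simp only [Set.mem_ofPred_eq, Set.mem_singleton_iff, forall_eq]
  rw [RingHom.map_det]
  unfold minor
  congr! 2
  ext i j
  simp

/-- A minor that vanishes on a subset of `G / P_r` vanishes on its closure. -/
lemma minor_eq_zero_of_mem_closure {r : ℕ} (hr : 1 ≤ r) (f : UpperIdx t n r → Idx t n)
    {Y : Set (algGroup K t n ⧸ parabolic K t n r)}
    (hY : ∀ g, QuotientGroup.mk g ∈ Y → minor f g = 0) {g : algGroup K t n}
    (hg : QuotientGroup.mk g ∈ closure[flagTopology K t n r] Y) : minor f g = 0 := by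
  let _ := flagTopology K t n r
  have hcl : IsClosed {x : algGroup K t n ⧸ parabolic K t n r |
      ∀ g, QuotientGroup.mk g = x → minor f g = 0} := by
    rw [isClosed_coinduced]
    convert isClosed_minor_eq_zero (K := K) f using 1
    ext g
    exact ⟨fun h => h g rfl, fun h g' hg' => minor_eq_zero_of_mk_eq hr f hg'.symm h⟩
  refine closure_minimal ?_ hcl hg g rfl
  rintro x hx g rfl
  exact hY g hx

/-- The columns of an invertible matrix have a nonzero maximal minor. -/
lemma exists_minor_ne_zero {r : ℕ} (g : algGroup K t n) :
    ∃ f : UpperIdx t n r → Idx t n, minor f g ≠ 0 := by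
  by_contra! h
  have h1 : (Matrix.of fun i j : UpperIdx t n r => entry (g⁻¹ * g) i j).det = 1 := by
    rw [← Matrix.det_one (n := UpperIdx t n r)]
    congr 1
    ext i j
    rw [inv_mul_cancel, Matrix.of_apply, entry_one, Matrix.one_apply]
    simp only [Subtype.ext_iff]
  -- The rows of `g⁻¹ * g` are combinations of the rows of `g`; multilinear expansion writes `1` as
  -- a combination of the minors of `g`.
  have h2 : (Matrix.of fun i j : UpperIdx t n r => entry (g⁻¹ * g) i j).det =
      Matrix.detRowAlternating.toMultilinearMap (fun i : UpperIdx t n r =>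
        ∑ a : Idx t n, entry g⁻¹ i a • fun j : UpperIdx t n r => entry g a j) := by
    change _ = Matrix.det (fun i : UpperIdx t n r =>
        ∑ a : Idx t n, entry g⁻¹ i a • fun j : UpperIdx t n r => entry g a j)
    congr 1
    ext i j
    rw [Matrix.of_apply, entry_mul, Finset.sum_apply]
    rfl
  rw [MultilinearMap.map_sum] at h2
  rw [h2, Finset.sum_eq_zero] at h1
  · exact zero_ne_one h1
  · intro f _
    rw [MultilinearMap.map_smul_univ]
    have := h f
    unfold minor at this
    exact smul_eq_zero_of_right _ this

lemma exists_perm_of_minor_ne_zero {r : ℕ} {f : UpperIdx t n r → Idx t n} {g : algGroup K t n}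
    (h : minor f g ≠ 0) :
    ∃ σ : Equiv.Perm (UpperIdx t n r), ∀ i, entry g (f (σ i)) i ≠ 0 := by
  unfold minor at h
  rw [Matrix.det_apply] at h
  obtain ⟨σ, _, hσ⟩ := Finset.exists_ne_zero_of_sum_ne_zero h
  refine ⟨σ, fun i hi => hσ ?_⟩
  rw [Finset.prod_eq_zero (Finset.mem_univ i) hi, smul_zero]

lemma exists_of_entry_mul_representative {w : Equiv.Perm ℤ} {b g : algGroup K t n}
    (hg : g ∈ representatives K t n w) {a i : Idx t n} (h : entry (b * g) a i ≠ 0) :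
    ∃ c : Idx t n, (c : ℤ) = w i ∧ entry b a c ≠ 0 := by
  rw [entry_mul] at h
  obtain ⟨c, _, hc⟩ := Finset.exists_ne_zero_of_sum_ne_zero h
  exact ⟨c, (hg c i).1 (right_ne_zero_of_mul hc), left_ne_zero_of_mul hc⟩

lemma upCount_values_eq {r : ℕ} (hr : 1 ≤ r) (w : Equiv.Perm ℤ) (c : ℤ) :
    upCount (values r n w) c =
      ∑ i : UpperIdx t n r, if c ≤ w (i : Idx t n) then (1 : ℤ) else 0 := by
  rw [upCount, sum_values, sum_upperIdx hr (fun x => if c ≤ w x then (1 : ℤ) else 0)]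

/-- On the cell `B w P_r`, a nonzero term of the Leibniz expansion matches each column `i` with a
row `≥ w i`, since `B` only raises indices. A minor whose rows violate the inequality vanishes on
the cell, hence on its closure. -/
lemma upCount_le_of_mem_schubertVariety {r : ℕ} (hr : 1 ≤ r) {w : Equiv.Perm ℤ}
    {g : algGroup K t n} (hg : QuotientGroup.mk g ∈ schubertVariety K t n r w)
    {f : UpperIdx t n r → Idx t n} (hf : minor f g ≠ 0) (c : ℤ) :
    upCount (values r n w) c ≤ ∑ i, if c ≤ (f i : ℤ) then (1 : ℤ) else 0 := by
  by_contra hlt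
  refine hf (minor_eq_zero_of_mem_closure hr f ?_ hg)
  rintro g' ⟨b, hb, h, hh, hg'⟩
  refine minor_eq_zero_of_mk_eq hr f hg'.symm ?_
  by_contra hne
  obtain ⟨σ, hσ⟩ := exists_perm_of_minor_ne_zero hne
  refine hlt ?_
  rw [upCount_values_eq (t := t) hr,
    ← Equiv.sum_comp σ fun i => if c ≤ (f i : ℤ) then (1 : ℤ) else 0]
  refine Finset.sum_le_sum fun i _ => ?_
  obtain ⟨d, hd, hbd⟩ := exists_of_entry_mul_representative hh (hσ i)
  have := hb _ _ hbd
  split_ifs <;> omega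

lemma le_upCount_of_mem_oppSchubertVariety {r : ℕ} (hr : 1 ≤ r) {v : Equiv.Perm ℤ}
    {g : algGroup K t n} (hg : QuotientGroup.mk g ∈ oppSchubertVariety K t n r v)
    {f : UpperIdx t n r → Idx t n} (hf : minor f g ≠ 0) (c : ℤ) :
    (∑ i, if c ≤ (f i : ℤ) then (1 : ℤ) else 0) ≤ upCount (values r n v) c := by
  by_contra hlt
  refine hf (minor_eq_zero_of_mem_closure hr f ?_ hg)
  rintro g' ⟨b, hb, h, hh, hg'⟩
  refine minor_eq_zero_of_mk_eq hr f hg'.symm ?_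
  by_contra hne
  obtain ⟨σ, hσ⟩ := exists_perm_of_minor_ne_zero hne
  refine hlt ?_
  rw [upCount_values_eq (t := t) hr, ← Equiv.sum_comp σ]
  refine Finset.sum_le_sum fun i _ => ?_
  obtain ⟨d, hd, hbd⟩ := exists_of_entry_mul_representative hh (hσ i)
  have := hb _ _ hbd
  split_ifs <;> omega

/-- Nonempty Richardson varieties satisfy the Gale condition. -/
theorem galeLE_of_richardsonVariety_nonempty {r : ℕ} (hr : 1 ≤ r) {v w : Equiv.Perm ℤ}
    (h : (richardsonVariety K t n r v w).Nonempty) :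
    GaleLE (values r n w) (values r n v) := by
  obtain ⟨x, hx1, hx2⟩ := h
  obtain ⟨g, rfl⟩ := QuotientGroup.mk_surjective x
  obtain ⟨f, hf⟩ := exists_minor_ne_zero (r := r) g
  exact fun c => (upCount_le_of_mem_schubertVariety hr hx1 hf c).trans
    (le_upCount_of_mem_oppSchubertVariety hr hx2 hf c)

/-! ### Root subgroups -/

/-- The invariance of the quadratic or the symplectic form under a linear map. -/
def PreservesFormMap : (t : DynkinType) → ((Idx t n → K) →ₗ[K] (Idx t n → K)) → Prop
  | .B, L => ∀ x, quadForm (L x) = quadForm x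
  | .C, L => ∀ x y, sympForm (L x) (L y) = sympForm x y

/-- A multiplicative action of the `2 × 2` matrices `(p, q; r, s)` on the natural representation
such that the matrices of determinant one preserve the form. -/
structure TwoByTwoAction (K : Type*) [Field K] (t : DynkinType) (n : ℕ) where
  /-- the linear map attached to a matrix -/
  toMap : K → K → K → K → (Idx t n → K) →ₗ[K] (Idx t n → K)
  mul : ∀ p q r s p' q' r' s', toMap p q r s ∘ₗ toMap p' q' r' s' =
    toMap (p * p' + q * r') (p * q' + q * s') (r * p' + s * r') (r * q' + s * s')
  one : toMap 1 0 0 1 = LinearMap.id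
  form : ∀ p q r s, p * s - q * r = 1 → PreservesFormMap t (toMap p q r s)

namespace TwoByTwoAction

variable (L : TwoByTwoAction K t n)

/-- The matrix of the action. -/
def mat (p q r s : K) : Matrix (Idx t n) (Idx t n) K := LinearMap.toMatrix' (L.toMap p q r s)

lemma mat_apply (p q r s : K) (k l : Idx t n) :
    L.mat p q r s k l = L.toMap p q r s (Pi.single l 1) k := by
  rw [mat, LinearMap.toMatrix'_apply]

lemma mat_mul (p q r s p' q' r' s' : K) : L.mat p q r s * L.mat p' q' r' s' =
    L.mat (p * p' + q * r') (p * q' + q * s') (r * p' + s * r') (r * q' + s * s') := by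
  rw [mat, mat, ← LinearMap.toMatrix'_comp, L.mul]
  rfl

lemma mat_one : L.mat 1 0 0 1 = 1 := by
  rw [mat, L.one, LinearMap.toMatrix'_id]

/-- A unipotent element is a commutator with a diagonal one, hence has determinant one, as `SO`
requires. With `x` on the diagonal the commutator multiplies the parameter by `x ^ 2 - 1`, so `x` is
chosen with `x ≠ 0` and `x ^ 2 ≠ 1`. -/
lemma det_lower [IsAlgClosed K] (c : K) : (L.mat 1 0 c 1).det = 1 := by
  obtain ⟨x, hx0, hx⟩ : ∃ x : K, x ≠ 0 ∧ x ^ 2 - 1 ≠ 0 := by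
    have h0 : (Polynomial.X * (Polynomial.X ^ 2 - 1) : Polynomial K) ≠ 0 := by
      refine mul_ne_zero Polynomial.X_ne_zero ?_
      exact (Polynomial.monic_X_pow_sub_C (1 : K) two_ne_zero).ne_zero
    obtain ⟨x, hx⟩ := Polynomial.exists_eval_ne_zero_of_natDegree_lt_card _ h0
      ((Cardinal.natCast_lt_aleph0).trans_le (Cardinal.aleph0_le_mk K))
    exact ⟨x, by simpa [mul_eq_zero, not_or] using hx⟩
  have h1 : L.mat 1 0 c 1 = L.mat x⁻¹ 0 0 x * L.mat 1 0 (c / (x ^ 2 - 1)) 1 * L.mat x 0 0 x⁻¹ *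
      L.mat 1 0 (-(c / (x ^ 2 - 1))) 1 := by
    rw [mat_mul, mat_mul, mat_mul]
    congr 1 <;> field_simp <;> ring
  have h2 : (L.mat x⁻¹ 0 0 x).det * (L.mat x 0 0 x⁻¹).det = 1 := by
    rw [← Matrix.det_mul, mat_mul]
    simp [hx0, mat_one]
  have h3 : (L.mat 1 0 (c / (x ^ 2 - 1)) 1).det * (L.mat 1 0 (-(c / (x ^ 2 - 1))) 1).det = 1 := by
    rw [← Matrix.det_mul, mat_mul]
    simp [mat_one]
  rw [h1, Matrix.det_mul, Matrix.det_mul, Matrix.det_mul]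
  linear_combination (L.mat 1 0 (c / (x ^ 2 - 1)) 1).det *
    (L.mat 1 0 (-(c / (x ^ 2 - 1))) 1).det * h2 + h3

lemma det_upper [IsAlgClosed K] (c : K) : (L.mat 1 c 0 1).det = 1 := by
  have h1 : L.mat 1 c 0 1 = L.mat 0 1 (-1) 0 * L.mat 1 0 (-c) 1 * L.mat 0 (-1) 1 0 := by
    rw [mat_mul, mat_mul]
    congr 1 <;> ring
  have h2 : (L.mat 0 1 (-1) 0).det * (L.mat 0 (-1) 1 0).det = 1 := by
    rw [← Matrix.det_mul, mat_mul]
    simp [mat_one]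
  rw [h1, Matrix.det_mul, Matrix.det_mul, det_lower, mul_one, h2]

/-- The element of `G` attached to a matrix that acts with determinant one. -/
def elt (p q r s : K) (h : p * s - q * r = 1) (hdet : (L.mat p q r s).det = 1) :
    algGroup K t n :=
  ⟨⟨L.mat p q r s, L.mat s (-q) (-r) p, by
      rw [mat_mul, ← mat_one L]; congr 1 <;> first | ring1 | linear_combination h, by
      rw [mat_mul, ← mat_one L]; congr 1 <;> first | ring1 | linear_combination h⟩, by
    have hL := L.form p q r s h
    have hv : ∀ x, (L.mat p q r s).mulVec x = L.toMap p q r s x := fun x =>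
      LinearMap.toMatrix'_mulVec _ _
    change PreservesForm t (L.mat p q r s)
    cases t with
    | B => exact ⟨fun x => by rw [hv]; exact hL x, hdet⟩
    | C => exact fun x y => by rw [hv, hv]; exact hL x y⟩

/-- The root subgroup of the lower triangular unipotent matrices. -/
def lower [IsAlgClosed K] (c : K) : algGroup K t n := L.elt 1 0 c 1 (by ring) (L.det_lower c)

/-- The root subgroup of the upper triangular unipotent matrices. -/
def upper [IsAlgClosed K] (c : K) : algGroup K t n := L.elt 1 c 0 1 (by ring) (L.det_upper c)

lemma val_lower [IsAlgClosed K] (c : K) : (L.lower c : GL (Idx t n) K).1 = L.mat 1 0 c 1 := rfl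

lemma val_upper [IsAlgClosed K] (c : K) : (L.upper c : GL (Idx t n) K).1 = L.mat 1 c 0 1 := rfl

end TwoByTwoAction

lemma algGroup_ext {g h : algGroup K t n}
    (H : (g : GL (Idx t n) K).1 = (h : GL (Idx t n) K).1) : g = h :=
  Subtype.ext (Units.ext H)

/-- The root subgroups `E`, `F` of a root and its negative together with representatives `N` of
the reflection. -/
structure IsRootTriple (a b : ℤ) (E F N : K → algGroup K t n) : Prop where
  -- For `u = 1` this puts `E c` into `B` when `a < b`; for other `u` it puts the conjugate by a
  -- representative of `u` into `B`.
  lower : ∀ c k l, entry (E c) k l ≠ 0 → ∀ u ∈ weylGroup n, u a < u b → u l ≤ u k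
  poly : ∀ k l, ∃ P : Polynomial K, ∀ c, entry (F c) k l = P.eval c
  zero : F 0 = 1
  rep : ∀ c, c ≠ 0 → N c ∈ representatives K t n (signedSwap a b)
  -- This is `(1, c; 0, 1) = (1, 0; c⁻¹, 1) (0, c; -c⁻¹, 0) (1, 0; c⁻¹, 1)`.
  eq : ∀ c, c ≠ 0 → F c = E c⁻¹ * N c * E c⁻¹

lemma TwoByTwoAction.exists_isRootTriple [IsAlgClosed K] (L : TwoByTwoAction K t n) (a b : ℤ)
    (hE : ∀ c k l, L.toMap 1 0 c 1 (Pi.single l 1) k ≠ 0 →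
      ∀ u ∈ weylGroup n, u a < u b → u l ≤ u k)
    (hF : ∀ k l, ∃ P : Polynomial K, ∀ c, L.toMap 1 c 0 1 (Pi.single l 1) k = P.eval c)
    (hN : ∀ c, c ≠ 0 → ∀ k l, L.toMap 0 c (-c⁻¹) 0 (Pi.single l 1) k ≠ 0 ↔
      (k : ℤ) = signedSwap a b l) :
    ∃ E F N : K → algGroup K t n, IsRootTriple a b E F N := by
  refine ⟨L.lower, L.upper, fun c => L.lower (-c⁻¹) * L.upper c * L.lower (-c⁻¹), ?_, ?_, ?_, ?_,
    ?_⟩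
  · intro c k l h
    rw [entry, L.val_lower, L.mat_apply] at h
    exact hE c k l h
  · intro k l
    obtain ⟨P, hP⟩ := hF k l
    exact ⟨P, fun c => by rw [entry, L.val_upper, L.mat_apply, hP]⟩
  · refine algGroup_ext ?_
    rw [L.val_upper, L.mat_one]
    rfl
  · intro c hc k l
    have : ((L.lower (-c⁻¹) * L.upper c * L.lower (-c⁻¹) : algGroup K t n) :
        GL (Idx t n) K).1 = L.mat 0 c (-c⁻¹) 0 := by
      change L.mat 1 0 (-c⁻¹) 1 * L.mat 1 c 0 1 * L.mat 1 0 (-c⁻¹) 1 = _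
      rw [L.mat_mul, L.mat_mul]
      congr 1 <;> field_simp <;> ring
    rw [entry, this, L.mat_apply]
    exact hN c hc k l
  · intro c hc
    have h : L.lower c⁻¹ * L.lower (-c⁻¹) = 1 := by
      refine algGroup_ext ?_
      change L.mat 1 0 c⁻¹ 1 * L.mat 1 0 (-c⁻¹) 1 = 1
      rw [L.mat_mul, ← L.mat_one]
      congr 1 <;> ring
    have h' : L.lower (-c⁻¹) * L.lower c⁻¹ = 1 := by
      rw [mul_eq_one_iff_eq_inv] at h ⊢
      rw [h, inv_inv]
    simp only [mul_assoc, h', mul_one]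
    rw [← mul_assoc, h, one_mul]

/-! ### The actions of `SL_2` attached to the roots. -/

/-- The index `-a`. -/
def Idx.opp (a : Idx t n) : Idx t n :=
  ⟨-a.1, by
    have := Finset.mem_Icc.1 a.2.1
    rw [Finset.mem_Icc]
    omega, fun h => by simpa using a.2.2 h⟩

@[simp] lemma Idx.coe_opp (a : Idx t n) : (a.opp : ℤ) = -a := rfl

@[simp] lemma Idx.opp_opp (a : Idx t n) : a.opp.opp = a := Subtype.ext (neg_neg _)

lemma Idx.ext_iff' {a b : Idx t n} : a = b ↔ (a : ℤ) = b := Subtype.ext_iff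

lemma quadForm_eq (x : Idx t n → K) :
    quadForm x = ∑ a : Idx t n, if 0 ≤ (a : ℤ) then x a * x a.opp else 0 := by
  refine Finset.sum_congr rfl fun a _ => ?_
  rw [Finset.sum_eq_single_of_mem a.opp (Finset.mem_univ _)]
  · simp
  · intro b _ hb
    rw [if_neg]
    intro h
    exact hb (Idx.ext_iff'.2 (by rw [Idx.coe_opp]; omega))

lemma sympForm_eq (x y : Idx t n → K) :
    sympForm x y = ∑ a : Idx t n, ((Int.sign (a : ℤ) : ℤ) : K) * (x a * y a.opp) := by
  refine Finset.sum_congr rfl fun a _ => ?_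
  rw [Finset.sum_eq_single_of_mem a.opp (Finset.mem_univ _)]
  · simp
  · intro b _ hb
    rw [if_neg]
    intro h
    exact hb (Idx.ext_iff'.2 (by rw [Idx.coe_opp]; omega))

/-- The sum over the nonnegative indices of an even function supported on `±a` and `±b`. -/
lemma sum_nonneg_of_even {d : Idx t n → K} (hd : ∀ k, d k.opp = d k) {a b : Idx t n} (hab : a ≠ b)
    (hab' : a ≠ b.opp)
    (hsupp : ∀ k, k ≠ a → k ≠ b → k ≠ a.opp → k ≠ b.opp → d k = 0) :
    (∑ k : Idx t n, if 0 ≤ (k : ℤ) then d k else 0) = d a + d b := by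
  obtain ⟨a', ha', ha0, hda⟩ : ∃ a', (a' = a ∨ a' = a.opp) ∧ 0 ≤ (a' : ℤ) ∧ d a' = d a := by
    rcases le_total 0 (a : ℤ) with h | h
    · exact ⟨a, Or.inl rfl, h, rfl⟩
    · exact ⟨a.opp, Or.inr rfl, by rw [Idx.coe_opp]; omega, hd a⟩
  obtain ⟨b', hb', hb0, hdb⟩ : ∃ b', (b' = b ∨ b' = b.opp) ∧ 0 ≤ (b' : ℤ) ∧ d b' = d b := by
    rcases le_total 0 (b : ℤ) with h | h
    · exact ⟨b, Or.inl rfl, h, rfl⟩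
    · exact ⟨b.opp, Or.inr rfl, by rw [Idx.coe_opp]; omega, hd b⟩
  have hne : a' ≠ b' := by
    simp only [Idx.ext_iff', ne_eq, Idx.coe_opp] at *
    omega
  rw [← Finset.sum_subset (Finset.subset_univ {a', b'}), Finset.sum_pair hne, if_pos ha0,
    if_pos hb0, hda, hdb]
  intro k _ hk
  simp only [Finset.mem_insert, Finset.mem_singleton, not_or] at hk
  by_cases hk0 : 0 ≤ (k : ℤ)
  · rw [if_pos hk0]
    apply hsupp <;> (simp only [Idx.ext_iff', ne_eq, Idx.coe_opp] at *; omega)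
  · rw [if_neg hk0]

section Rotation

variable (η : K) (a b : Idx t n)

/-- The action of `(p, q; r, s)` on the span of the basis vectors `a`, `b`, and dually on that of
`-a`, `-b`. -/
def rotation (p q r s : K) : (Idx t n → K) →ₗ[K] (Idx t n → K) where
  toFun v k := if k = a then p * v a + q * v b else if k = b then r * v a + s * v b
    else if k = a.opp then s * v a.opp - η * r * v b.opp
    else if k = b.opp then p * v b.opp - η * q * v a.opp else v k
  map_add' v w := by
    ext k
    simp only [Pi.add_apply]
    split_ifs <;> ring
  map_smul' c v := by
    ext k
    simp only [Pi.smul_apply, smul_eq_mul, RingHom.id_apply]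
    split_ifs <;> ring

lemma rotation_apply (p q r s : K) (v : Idx t n → K) (k : Idx t n) :
    rotation η a b p q r s v k =
      if k = a then p * v a + q * v b else if k = b then r * v a + s * v b
      else if k = a.opp then s * v a.opp - η * r * v b.opp
      else if k = b.opp then p * v b.opp - η * q * v a.opp else v k := rfl

variable {η a b} (hη : η * η = 1) (ha : (a : ℤ) ≠ 0) (hb : (b : ℤ) ≠ 0) (hab : (a : ℤ) ≠ b)
  (hab' : (a : ℤ) ≠ -b)

include ha hb hab hab' in
lemma rotation_apply_values (p q r s : K) (v : Idx t n → K) :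
    rotation η a b p q r s v a = p * v a + q * v b ∧
    rotation η a b p q r s v b = r * v a + s * v b ∧
    rotation η a b p q r s v a.opp = s * v a.opp - η * r * v b.opp ∧
    rotation η a b p q r s v b.opp = p * v b.opp - η * q * v a.opp := by
  have h1 : b ≠ a := by rw [ne_eq, Idx.ext_iff']; omega
  have h2 : a.opp ≠ a := by rw [ne_eq, Idx.ext_iff', Idx.coe_opp]; omega
  have h3 : a.opp ≠ b := by rw [ne_eq, Idx.ext_iff', Idx.coe_opp]; omega
  have h4 : b.opp ≠ a := by rw [ne_eq, Idx.ext_iff', Idx.coe_opp]; omega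
  have h5 : b.opp ≠ b := by rw [ne_eq, Idx.ext_iff', Idx.coe_opp]; omega
  have h6 : b.opp ≠ a.opp := by rw [ne_eq, Idx.ext_iff', Idx.coe_opp, Idx.coe_opp]; omega
  refine ⟨?_, ?_, ?_, ?_⟩ <;> rw [rotation_apply] <;> simp [h1, h2, h3, h4, h5, h6]

lemma rotation_apply_other (p q r s : K) (v : Idx t n → K) {k : Idx t n} (h1 : k ≠ a) (h2 : k ≠ b)
    (h3 : k ≠ a.opp) (h4 : k ≠ b.opp) : rotation η a b p q r s v k = v k := by
  rw [rotation_apply, if_neg h1, if_neg h2, if_neg h3, if_neg h4]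

end Rotation

section Rotation

variable {η : K} {a b : Idx t n} (hη : η * η = 1) (ha : (a : ℤ) ≠ 0) (hb : (b : ℤ) ≠ 0)
  (hab : (a : ℤ) ≠ b) (hab' : (a : ℤ) ≠ -b)

lemma eq_or_other (k : Idx t n) : (k = a ∨ k = b ∨ k = a.opp ∨ k = b.opp) ∨
    (k ≠ a ∧ k ≠ b ∧ k ≠ a.opp ∧ k ≠ b.opp) := by tauto

include hη ha hb hab hab' in
lemma rotation_mul (p q r s p' q' r' s' : K) :
    rotation η a b p q r s ∘ₗ rotation η a b p' q' r' s' =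
    rotation η a b (p * p' + q * r') (p * q' + q * s') (r * p' + s * r') (r * q' + s * s') := by
  refine LinearMap.ext fun v => funext fun k => ?_
  rw [LinearMap.comp_apply]
  obtain ⟨e1, e2, e3, e4⟩ := rotation_apply_values (η := η) ha hb hab hab' p' q' r' s' v
  obtain ⟨f1, f2, f3, f4⟩ := rotation_apply_values (η := η) ha hb hab hab' p q r s
    (rotation η a b p' q' r' s' v)
  obtain ⟨g1, g2, g3, g4⟩ := rotation_apply_values (η := η) ha hb hab hab' (p * p' + q * r')
    (p * q' + q * s') (r * p' + s * r') (r * q' + s * s') v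
  rcases eq_or_other (a := a) (b := b) k with (rfl | rfl | rfl | rfl) | ⟨h1, h2, h3, h4⟩
  · rw [f1, g1, e1, e2]; ring
  · rw [f2, g2, e1, e2]; ring
  · rw [f3, g3, e3, e4]; linear_combination (r * q' * v a.opp) * hη
  · rw [f4, g4, e3, e4]; linear_combination (q * r' * v b.opp) * hη
  · rw [rotation_apply_other _ _ _ _ _ h1 h2 h3 h4, rotation_apply_other _ _ _ _ _ h1 h2 h3 h4,
      rotation_apply_other _ _ _ _ _ h1 h2 h3 h4]

lemma rotation_one : rotation η a b 1 0 0 1 = LinearMap.id := by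
  refine LinearMap.ext fun v => funext fun k => ?_
  rw [rotation_apply, LinearMap.id_apply]
  split_ifs with h1 h2 h3 h4 <;> first | subst h1 | subst h2 | subst h3 | subst h4 | skip
  all_goals ring

end Rotation

/-- The products `x_k x_{-k}` are even in `k`, so only the pairs `±a` and `±b` matter. The case `b =
0` is allowed and serves the short roots of type `B`. -/
lemma quadForm_congr {x y : Idx t n → K} {a b : Idx t n} (hab : (a : ℤ) ≠ b)
    (hab' : (a : ℤ) ≠ -b)
    (hother : ∀ k, k ≠ a → k ≠ b → k ≠ a.opp → k ≠ b.opp → y k = x k)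
    (h : y a * y a.opp + y b * y b.opp = x a * x a.opp + x b * x b.opp) :
    quadForm y = quadForm x := by
  have := sum_nonneg_of_even (d := fun k => y k * y k.opp - x k * x k.opp) (a := a) (b := b)
    (fun k => by simp only [Idx.opp_opp]; ring)
    (by rw [ne_eq, Idx.ext_iff']; exact hab) (by rw [ne_eq, Idx.ext_iff']; exact hab') ?_
  · rw [quadForm_eq, quadForm_eq, ← sub_eq_zero, ← Finset.sum_sub_distrib]
    refine Eq.trans (Finset.sum_congr rfl fun k _ => ?_) (this.trans ?_)
    · split_ifs <;> ring
    · linear_combination h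
  · intro k h1 h2 h3 h4
    rw [hother k h1 h2 h3 h4, hother k.opp, sub_self] <;>
      (simp only [Idx.ext_iff', ne_eq, Idx.coe_opp] at *; omega)

lemma sign_coe_opp (a : Idx t n) :
    ((Int.sign (a.opp : ℤ) : ℤ) : K) = -((Int.sign (a : ℤ) : ℤ) : K) := by
  rw [Idx.coe_opp, Int.sign_neg]
  push_cast
  rfl

lemma sign_mul_sign {a : Idx t n} (ha : (a : ℤ) ≠ 0) :
    ((Int.sign (a : ℤ) : ℤ) : K) * ((Int.sign (a : ℤ) : ℤ) : K) = 1 := by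
  rcases lt_or_gt_of_ne ha with h | h
  · rw [Int.sign_eq_neg_one_of_neg h]; norm_num
  · rw [Int.sign_eq_one_of_pos h]; norm_num

lemma sympForm_congr {x y x' y' : Idx t n → K} {S : Finset (Idx t n)}
    (hother : ∀ k ∉ S, x' k = x k ∧ y' k.opp = y k.opp)
    (h : ∑ k ∈ S, ((Int.sign (k : ℤ) : ℤ) : K) * (x' k * y' k.opp) =
      ∑ k ∈ S, ((Int.sign (k : ℤ) : ℤ) : K) * (x k * y k.opp)) :
    sympForm x' y' = sympForm x y := by
  rw [sympForm_eq, sympForm_eq, ← sub_eq_zero, ← Finset.sum_sub_distrib,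
    ← Finset.sum_subset (Finset.subset_univ S), Finset.sum_sub_distrib, h, sub_self]
  intro k _ hk
  rw [(hother k hk).1, (hother k hk).2, sub_self]

section Rotation

variable {η : K} {a b : Idx t n} (hη : η * η = 1) (ha : (a : ℤ) ≠ 0) (hb : (b : ℤ) ≠ 0)
  (hab : (a : ℤ) ≠ b) (hab' : (a : ℤ) ≠ -b)

lemma rotation_preserves_quadForm {a b : Idx .B n} (ha : (a : ℤ) ≠ 0) (hb : (b : ℤ) ≠ 0)
    (hab : (a : ℤ) ≠ b) (hab' : (a : ℤ) ≠ -b) {p q r s : K} (h : p * s - q * r = 1) :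
    PreservesFormMap .B (rotation 1 a b p q r s) := by
  intro x
  obtain ⟨e1, e2, e3, e4⟩ := rotation_apply_values (η := 1) ha hb hab hab' p q r s x
  refine quadForm_congr hab hab' (fun k => rotation_apply_other _ _ _ _ _) ?_
  rw [e1, e2, e3, e4]
  linear_combination (x a * x a.opp + x b * x b.opp) * h

/-- The form pairs `±a` with the sign of `a`, so the inverse transpose acting on `-a`, `-b` must be
twisted by the product of the signs of `a` and `b`. -/
lemma rotation_preserves_sympForm {a b : Idx .C n} (ha : (a : ℤ) ≠ 0) (hb : (b : ℤ) ≠ 0)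
    (hab : (a : ℤ) ≠ b) (hab' : (a : ℤ) ≠ -b) {p q r s : K} (h : p * s - q * r = 1) :
    PreservesFormMap .C (rotation (((Int.sign (a : ℤ) : ℤ) : K) * ((Int.sign (b : ℤ) : ℤ) : K))
      a b p q r s) := by
  intro x y
  have hsa := sign_mul_sign (K := K) ha
  have hsb := sign_mul_sign (K := K) hb
  have na := sign_coe_opp (K := K) a
  have nb := sign_coe_opp (K := K) b
  set sa : K := ((Int.sign (a : ℤ) : ℤ) : K)
  set sb : K := ((Int.sign (b : ℤ) : ℤ) : K)
  obtain ⟨e1, e2, e3, e4⟩ := rotation_apply_values (η := sa * sb) ha hb hab hab' p q r s x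
  obtain ⟨f1, f2, f3, f4⟩ := rotation_apply_values (η := sa * sb) ha hb hab hab' p q r s y
  refine sympForm_congr (S := {a, b, a.opp, b.opp}) ?_ ?_
  · intro k hk
    simp only [Finset.mem_insert, Finset.mem_singleton, not_or] at hk
    obtain ⟨h1, h2, h3, h4⟩ := hk
    refine ⟨rotation_apply_other _ _ _ _ _ h1 h2 h3 h4, ?_⟩
    apply rotation_apply_other <;> (simp only [Idx.ext_iff', ne_eq, Idx.coe_opp] at *; omega)
  · have hsum : ∀ f : Idx .C n → K, ∑ k ∈ ({a, b, a.opp, b.opp} : Finset (Idx .C n)), f k =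
        f a + (f b + (f a.opp + f b.opp)) := by
      intro f
      rw [Finset.sum_insert, Finset.sum_insert, Finset.sum_pair] <;>
        (try simp only [Finset.mem_insert, Finset.mem_singleton, not_or]) <;>
        (simp only [Idx.ext_iff', ne_eq, Idx.coe_opp] at *; omega)
    rw [hsum, hsum]
    simp only [Idx.opp_opp, e1, e2, e3, e4, f1, f2, f3, f4, na, nb]
    linear_combination
      sb * (-(p * x a + q * x b) * r * y b.opp + r * x b.opp * (p * y a + q * y b)) * hsa +
      sa * (-(r * x a + s * x b) * q * y a.opp + q * x a.opp * (r * y a + s * y b)) * hsb +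
      (sa * (x a * y a.opp - x a.opp * y a) + sb * (x b * y b.opp - x b.opp * y b)) * h

include hη ha hb hab hab' in
lemma exists_isRootTriple_rotation [IsAlgClosed K]
    (hform : ∀ p q r s : K, p * s - q * r = 1 → PreservesFormMap t (rotation η a b p q r s)) :
    ∃ E F N : K → algGroup K t n, IsRootTriple a b E F N := by
  have hη0 : η ≠ 0 := by rintro rfl; simp at hη
  refine TwoByTwoAction.exists_isRootTriple
    ⟨rotation η a b, rotation_mul hη ha hb hab hab', rotation_one, hform⟩ a b ?_ ?_ ?_
  · intro c k l h u hu hlt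
    have key : k = l ∨ (k = b ∧ l = a) ∨ (k = a.opp ∧ l = b.opp) := by
      dsimp only at h
      rw [rotation_apply] at h
      simp only [Pi.single_apply] at h
      split_ifs at h <;> simp_all
    rcases key with rfl | ⟨rfl, rfl⟩ | ⟨rfl, rfl⟩
    · exact le_rfl
    · exact hlt.le
    · rw [Idx.coe_opp, Idx.coe_opp, map_neg_of_mem hu, map_neg_of_mem hu]
      omega
  · intro k l
    let v : Idx t n → K := Pi.single l 1
    refine ⟨if k = a then Polynomial.C (v a) + Polynomial.C (v b) * Polynomial.X
      else if k = b then Polynomial.C (v b)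
      else if k = a.opp then Polynomial.C (v a.opp)
      else if k = b.opp then Polynomial.C (v b.opp) -
        Polynomial.C η * Polynomial.C (v a.opp) * Polynomial.X
      else Polynomial.C (v k), fun c => ?_⟩
    dsimp only
    rw [rotation_apply]
    split_ifs <;> simp [v] <;> ring
  · intro c hc k l
    have hiff : (k : ℤ) = signedSwap a b l ↔ (l : ℤ) = signedSwap a b k := by
      rw [← signedSwap_inv ha hb, Equiv.Perm.eq_inv_iff_eq, signedSwap_inv ha hb, eq_comm]
    rw [hiff, signedSwap_apply ha hb]
    obtain ⟨e1, e2, e3, e4⟩ := rotation_apply_values (η := η) ha hb hab hab' 0 c (-c⁻¹) 0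
      (Pi.single l 1)
    dsimp only
    rcases eq_or_other (a := a) (b := b) k with (rfl | rfl | rfl | rfl) | ⟨h1, h2, h3, h4⟩
    · rw [e1, if_pos rfl]
      simp [Pi.single_apply, hc, Idx.ext_iff', eq_comm]
    · rw [e2, if_neg (Ne.symm hab), if_pos rfl]
      simp [Pi.single_apply, hc, Idx.ext_iff', eq_comm]
    · rw [e3, Idx.coe_opp, if_neg (by omega), if_neg (by omega), if_pos rfl]
      simp [Pi.single_apply, hc, hη0, Idx.ext_iff', eq_comm]
    · rw [e4, Idx.coe_opp, if_neg (by omega), if_neg (by omega), if_neg (by omega), if_pos rfl]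
      simp [Pi.single_apply, hc, hη0, Idx.ext_iff', eq_comm]
    · rw [rotation_apply_other _ _ _ _ _ h1 h2 h3 h4]
      simp only [Idx.ext_iff', ne_eq, Idx.coe_opp] at h1 h2 h3 h4
      rw [if_neg h1, if_neg h2, if_neg h3, if_neg h4]
      simp [Pi.single_apply, Idx.ext_iff', eq_comm]

end Rotation

lemma Idx.opp_ne {a : Idx t n} (ha : (a : ℤ) ≠ 0) : a.opp ≠ a := by
  rw [ne_eq, Idx.ext_iff', Idx.coe_opp]
  omega

/-- The action of `(p, q; r, s)` on the span of the basis vectors `a` and `-a`. -/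
def planeAction (a : Idx t n) (p q r s : K) : (Idx t n → K) →ₗ[K] (Idx t n → K) where
  toFun v k := if k = a then p * v a + q * v a.opp
    else if k = a.opp then r * v a + s * v a.opp else v k
  map_add' v w := by
    ext k
    simp only [Pi.add_apply]
    split_ifs <;> ring
  map_smul' c v := by
    ext k
    simp only [Pi.smul_apply, smul_eq_mul, RingHom.id_apply]
    split_ifs <;> ring

lemma planeAction_apply (a : Idx t n) (p q r s : K) (v : Idx t n → K) (k : Idx t n) :
    planeAction a p q r s v k = if k = a then p * v a + q * v a.opp
      else if k = a.opp then r * v a + s * v a.opp else v k := rfl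

/-- The action of the symplectic group of the plane spanned by the basis vectors `a`, `-a`. -/
def planeTwoByTwo {a : Idx .C n} (ha : (a : ℤ) ≠ 0) : TwoByTwoAction K .C n where
  toMap := planeAction a
  mul p q r s p' q' r' s' := by
    refine LinearMap.ext fun v => funext fun k => ?_
    have h := Idx.opp_ne ha
    simp only [LinearMap.comp_apply, planeAction_apply, if_true, if_neg h]
    split_ifs <;> ring
  one := by
    refine LinearMap.ext fun v => funext fun k => ?_
    rw [planeAction_apply, LinearMap.id_apply]
    split_ifs with h1 h2
    · rw [h1]; ring
    · rw [h2]; ring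
    · rfl
  form p q r s hdet := by
    intro x y
    have h := Idx.opp_ne ha
    have na := sign_coe_opp (K := K) a
    refine sympForm_congr (S := {a, a.opp}) ?_ ?_
    · intro k hk
      simp only [Finset.mem_insert, Finset.mem_singleton, not_or] at hk
      rw [planeAction_apply, planeAction_apply, if_neg hk.1, if_neg hk.2, if_neg, if_neg]
      · exact ⟨rfl, rfl⟩
      all_goals (simp only [Idx.ext_iff', Idx.coe_opp] at *; omega)
    · rw [Finset.sum_pair h.symm, Finset.sum_pair h.symm, Idx.opp_opp, na]
      simp only [planeAction_apply, if_true, if_neg h]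
      linear_combination ((Int.sign (a : ℤ) : ℤ) : K) * (x a * y a.opp - x a.opp * y a) * hdet

lemma exists_isRootTriple_plane [IsAlgClosed K] {a : Idx .C n} (ha : (a : ℤ) ≠ 0) :
    ∃ E F N : K → algGroup K .C n, IsRootTriple a (-a) E F N := by
  have hne := Idx.opp_ne ha
  refine (planeTwoByTwo ha).exists_isRootTriple a (-a) ?_ ?_ ?_
  · intro c k l h u hu hlt
    have key : k = l ∨ (k = a.opp ∧ l = a) := by
      change planeAction a 1 0 c 1 (Pi.single l 1) k ≠ 0 at h
      rw [planeAction_apply] at h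
      simp only [Pi.single_apply] at h
      split_ifs at h <;> simp_all
    rcases key with rfl | ⟨rfl, rfl⟩
    · exact le_rfl
    · exact hlt.le
  · intro k l
    let v : Idx .C n → K := Pi.single l 1
    refine ⟨if k = a then Polynomial.C (v a) + Polynomial.C (v a.opp) * Polynomial.X
      else if k = a.opp then Polynomial.C (v a.opp) else Polynomial.C (v k), fun c => ?_⟩
    change planeAction a 1 c 0 1 (Pi.single l 1) k = _
    rw [planeAction_apply]
    split_ifs <;> simp [v]
    ring
  · intro c hc k l
    change planeAction a 0 c (-c⁻¹) 0 (Pi.single l 1) k ≠ 0 ↔ _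
    have hb : -(a : ℤ) ≠ 0 := by omega
    have hiff : (k : ℤ) = signedSwap a (-a) l ↔ (l : ℤ) = signedSwap a (-a) k := by
      rw [← signedSwap_inv ha hb, Equiv.Perm.eq_inv_iff_eq, signedSwap_inv ha hb, eq_comm]
    rw [hiff, signedSwap_apply ha hb, planeAction_apply]
    by_cases h1 : k = a
    · subst h1
      simp [Pi.single_apply, hc, Idx.ext_iff', eq_comm]
    · by_cases h2 : k = a.opp
      · subst h2
        rw [if_neg hne, if_pos rfl, Idx.coe_opp, if_neg (by omega), if_pos rfl]
        simp [Pi.single_apply, hc, Idx.ext_iff', eq_comm]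
      · rw [if_neg h1, if_neg h2]
        rw [Idx.ext_iff'] at h1 h2
        rw [Idx.coe_opp] at h2
        rw [if_neg h1, if_neg h2, if_neg h2, if_neg (by omega)]
        simp [Pi.single_apply, Idx.ext_iff', eq_comm]

/-- The index `0` in type `B`. -/
def Idx.zero : Idx .B n := ⟨0, by simp, by simp⟩

@[simp] lemma Idx.coe_zero : ((Idx.zero : Idx .B n) : ℤ) = 0 := rfl

@[simp] lemma Idx.opp_zero : (Idx.zero : Idx .B n).opp = Idx.zero := rfl

/-- The action of `(p, q; r, s)` on the span of the basis vectors `a`, `0` and `-a`, which is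
identified with the matrices of trace zero. -/
def adjointAction (a : Idx .B n) (p q r s : K) : (Idx .B n → K) →ₗ[K] (Idx .B n → K) where
  -- Conjugation of `(v_0, v_a; v_{-a}, -v_0)` by `(p, q; r, s)` of determinant one. It preserves
  -- the determinant `-(v_0 ^ 2 + v_a v_{-a})`, the negative of the quadratic form on this space.
  toFun v k := if k = a then p ^ 2 * v a - 2 * p * q * v Idx.zero - q ^ 2 * v a.opp
    else if k = a.opp then s ^ 2 * v a.opp + 2 * r * s * v Idx.zero - r ^ 2 * v a
    else if k = Idx.zero then (p * s + q * r) * v Idx.zero + q * s * v a.opp - p * r * v a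
    else v k
  map_add' v w := by
    ext k
    simp only [Pi.add_apply]
    split_ifs <;> ring
  map_smul' c v := by
    ext k
    simp only [Pi.smul_apply, smul_eq_mul, RingHom.id_apply]
    split_ifs <;> ring

lemma adjointAction_apply (a : Idx .B n) (p q r s : K) (v : Idx .B n → K) (k : Idx .B n) :
    adjointAction a p q r s v k =
      if k = a then p ^ 2 * v a - 2 * p * q * v Idx.zero - q ^ 2 * v a.opp
      else if k = a.opp then s ^ 2 * v a.opp + 2 * r * s * v Idx.zero - r ^ 2 * v a
      else if k = Idx.zero then (p * s + q * r) * v Idx.zero + q * s * v a.opp - p * r * v a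
      else v k := rfl

lemma Idx.zero_ne {a : Idx .B n} (ha : (a : ℤ) ≠ 0) : Idx.zero ≠ a ∧ Idx.zero ≠ a.opp := by
  rw [ne_eq, ne_eq, Idx.ext_iff', Idx.ext_iff', Idx.coe_opp, Idx.coe_zero]
  omega

/-- The action of the special orthogonal group of the space spanned by the basis vectors
`a`, `0`, `-a`. -/
def adjointTwoByTwo {a : Idx .B n} (ha : (a : ℤ) ≠ 0) : TwoByTwoAction K .B n where
  toMap := adjointAction a
  mul p q r s p' q' r' s' := by
    refine LinearMap.ext fun v => funext fun k => ?_
    have h := Idx.opp_ne ha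
    have h0 := Idx.zero_ne ha
    simp only [LinearMap.comp_apply, adjointAction_apply, if_true, if_neg h, if_neg h0.1,
      if_neg h0.2]
    split_ifs <;> ring
  one := by
    refine LinearMap.ext fun v => funext fun k => ?_
    rw [adjointAction_apply, LinearMap.id_apply]
    split_ifs with h1 h2 h3
    · rw [h1]; ring
    · rw [h2]; ring
    · rw [h3]; ring
    · rfl
  form p q r s hdet := by
    intro x
    have h := Idx.opp_ne ha
    have h0 := Idx.zero_ne ha
    refine quadForm_congr (a := a) (b := Idx.zero) (by simpa using ha) (by simpa using ha) ?_ ?_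
    · intro k h1 h2 h3 h4
      rw [adjointAction_apply, if_neg h1, if_neg h3, if_neg h2]
    · simp only [adjointAction_apply, if_true, if_neg h, if_neg h0.1, if_neg h0.2, Idx.opp_zero]
      linear_combination (x a * x a.opp + x Idx.zero * x Idx.zero) * (p * s - q * r + 1) * hdet

lemma exists_isRootTriple_adjoint [IsAlgClosed K] {a : Idx .B n} (ha : (a : ℤ) ≠ 0) :
    ∃ E F N : K → algGroup K .B n, IsRootTriple a (-a) E F N := by
  have hne := Idx.opp_ne ha
  have h0 := Idx.zero_ne ha
  refine (adjointTwoByTwo ha).exists_isRootTriple a (-a) ?_ ?_ ?_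
  · intro c k l h u hu hlt
    have key : k = l ∨ ((k = a.opp ∨ k = Idx.zero) ∧ (l = a ∨ l = Idx.zero)) := by
      change adjointAction a 1 0 c 1 (Pi.single l 1) k ≠ 0 at h
      rw [adjointAction_apply] at h
      simp only [Pi.single_apply] at h
      split_ifs at h <;> simp_all
    rw [map_neg_of_mem hu] at hlt
    rcases key with rfl | ⟨rfl | rfl, rfl | rfl⟩
    · exact le_rfl
    all_goals
      simp only [Idx.coe_opp, Idx.coe_zero, map_neg_of_mem hu, map_zero_of_mem hu]
      omega
  · intro k l
    let v : Idx .B n → K := Pi.single l 1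
    refine ⟨if k = a then Polynomial.C (v a) - Polynomial.C (2 * v Idx.zero) * Polynomial.X -
        Polynomial.C (v a.opp) * Polynomial.X ^ 2
      else if k = a.opp then Polynomial.C (v a.opp)
      else if k = Idx.zero then Polynomial.C (v Idx.zero) + Polynomial.C (v a.opp) * Polynomial.X
      else Polynomial.C (v k), fun c => ?_⟩
    change adjointAction a 1 c 0 1 (Pi.single l 1) k = _
    rw [adjointAction_apply]
    split_ifs <;> simp [v] <;> ring
  · intro c hc k l
    change adjointAction a 0 c (-c⁻¹) 0 (Pi.single l 1) k ≠ 0 ↔ _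
    have hc2 : ¬ 0 = c ^ 2 := (pow_ne_zero 2 hc).symm
    have hb : -(a : ℤ) ≠ 0 := by omega
    have hiff : (k : ℤ) = signedSwap a (-a) l ↔ (l : ℤ) = signedSwap a (-a) k := by
      rw [← signedSwap_inv ha hb, Equiv.Perm.eq_inv_iff_eq, signedSwap_inv ha hb, eq_comm]
    rw [hiff, signedSwap_apply ha hb, adjointAction_apply]
    by_cases h1 : k = a
    · subst h1
      simp [Pi.single_apply, hc2, Idx.ext_iff', eq_comm]
    · by_cases h2 : k = a.opp
      · subst h2
        rw [if_neg hne, if_pos rfl, Idx.coe_opp, if_neg (by omega), if_pos rfl]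
        simp [Pi.single_apply, hc2, Idx.ext_iff', eq_comm]
      · rw [if_neg h1, if_neg h2]
        rw [Idx.ext_iff'] at h1 h2
        rw [Idx.coe_opp] at h2
        by_cases h3 : k = Idx.zero
        · rw [if_pos h3, if_neg h1, if_neg h2, if_neg h2, if_neg (by omega), h3]
          simp [Pi.single_apply, hc, Idx.ext_iff', eq_comm]
        · rw [if_neg h3, if_neg h1, if_neg h2, if_neg h2, if_neg (by omega)]
          simp [Pi.single_apply, Idx.ext_iff', eq_comm]

/-- The index with a given nonzero value. -/
def Idx.ofInt (t : DynkinType) {n : ℕ} (a : ℤ) (ha : a ≠ 0) (ha' : |a| ≤ n) : Idx t n :=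
  ⟨a, by rw [abs_le] at ha'; rw [Finset.mem_Icc]; exact ha', fun _ => ha⟩

/-- For `b ≠ -a`, `SL_2` acts on a plane and dually on the opposite one. For `b = -a` it acts on the
plane of `±a` in type `C`, and by the adjoint representation on the span of the vectors `a`, `0`,
`-a` in type `B`. -/
theorem exists_isRootTriple (K : Type*) [Field K] [IsAlgClosed K] (t : DynkinType) {n : ℕ}
    {a b : ℤ} (ha : a ≠ 0) (hb : b ≠ 0) (ha' : |a| ≤ n) (hb' : |b| ≤ n) (hab : a ≠ b) :
    ∃ E F N : K → algGroup K t n, IsRootTriple a b E F N := by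
  by_cases h : b = -a
  · subst h
    cases t with
    | B => exact exists_isRootTriple_adjoint (a := Idx.ofInt .B a ha ha') ha
    | C => exact exists_isRootTriple_plane (a := Idx.ofInt .C a ha ha') ha
  · have hab' : a ≠ -b := by omega
    cases t with
    | B =>
      exact exists_isRootTriple_rotation (a := Idx.ofInt .B a ha ha') (b := Idx.ofInt .B b hb hb')
        (one_mul 1) ha hb hab hab' fun p q r s => rotation_preserves_quadForm ha hb hab hab'
    | C =>
      refine exists_isRootTriple_rotation (a := Idx.ofInt .C a ha ha')
        (b := Idx.ofInt .C b hb hb') ?_ ha hb hab hab'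
        fun p q r s => rotation_preserves_sympForm ha hb hab hab'
      rw [mul_mul_mul_comm, sign_mul_sign ha, sign_mul_sign hb, one_mul]

/-! ### Inclusions of Schubert varieties -/

/-- The action of the Weyl group on the indices. -/
def Idx.act {w : Equiv.Perm ℤ} (hw : w ∈ weylGroup n) (a : Idx t n) : Idx t n :=
  ⟨w a, by
    have h := Finset.mem_Icc.1 a.2.1
    rw [Finset.mem_Icc, ← abs_le]
    exact abs_map_le_of_mem hw (abs_le.2 h), fun h => map_ne_zero_of_mem hw (a.2.2 h)⟩

@[simp] lemma Idx.coe_act {w : Equiv.Perm ℤ} (hw : w ∈ weylGroup n) (a : Idx t n) :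
    (a.act hw : ℤ) = w a := rfl

lemma entry_mul_representative {w : Equiv.Perm ℤ} (hw : w ∈ weylGroup n) {g : algGroup K t n}
    (hg : g ∈ representatives K t n w) (h : algGroup K t n) (a b : Idx t n) :
    entry (h * g) a b = entry h a (b.act hw) * entry g (b.act hw) b := by
  rw [entry_mul, Finset.sum_eq_single_of_mem (b.act hw) (Finset.mem_univ _)]
  intro c _ hc
  have : entry g c b = 0 := by
    by_contra h
    exact hc (Idx.ext_iff'.2 ((hg c b).1 h))
  rw [this, mul_zero]

lemma entry_representative_mul {w : Equiv.Perm ℤ} (hw : w ∈ weylGroup n) {g : algGroup K t n}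
    (hg : g ∈ representatives K t n w) (h : algGroup K t n) (a b : Idx t n) :
    entry (g * h) (a.act hw) b = entry g (a.act hw) a * entry h a b := by
  rw [entry_mul, Finset.sum_eq_single_of_mem a (Finset.mem_univ _)]
  intro c _ hc
  have : entry g (a.act hw) c = 0 := by
    by_contra h
    have h1 := (hg _ c).1 h
    rw [Idx.coe_act] at h1
    exact hc (Idx.ext_iff'.2 (w.injective h1).symm)
  rw [this, zero_mul]

lemma mul_mem_representatives {σ w : Equiv.Perm ℤ} (hw : w ∈ weylGroup n)
    {g h : algGroup K t n} (hg : g ∈ representatives K t n σ)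
    (hh : h ∈ representatives K t n w) : g * h ∈ representatives K t n (σ * w) := by
  intro a b
  rw [entry_mul_representative hw hh, mul_ne_zero_iff, hg, hh, Idx.coe_act, Equiv.Perm.mul_apply]
  simp

lemma one_mem_borel : (1 : algGroup K t n) ∈ borel K t n := by
  intro a b h
  rw [entry_one] at h
  split_ifs at h with h1
  · rw [h1]
  · exact absurd rfl h

lemma one_mem_oppBorel : (1 : algGroup K t n) ∈ oppBorel K t n := by
  intro a b h
  rw [entry_one] at h
  split_ifs at h with h1
  · rw [h1]
  · exact absurd rfl h

lemma mul_mem_borel {g h : algGroup K t n} (hg : g ∈ borel K t n) (hh : h ∈ borel K t n) :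
    g * h ∈ borel K t n := by
  intro a b hab
  rw [entry_mul] at hab
  obtain ⟨c, _, hc⟩ := Finset.exists_ne_zero_of_sum_ne_zero hab
  exact (hh c b (right_ne_zero_of_mul hc)).trans (hg a c (left_ne_zero_of_mul hc))

/-- Every element of the Weyl group has a representative. -/
lemma representatives_nonempty [IsAlgClosed K] {w : Equiv.Perm ℤ} (hw : w ∈ weylGroup n) :
    (representatives K t n w).Nonempty := by
  obtain ⟨l, hl, rfl⟩ := exists_word hw
  clear hw
  induction l with
  | nil =>
    refine ⟨1, fun a b => ?_⟩
    rw [entry_one]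
    simp [Idx.ext_iff']
  | cons i l ih =>
    rw [isWord_cons] at hl
    obtain ⟨h, hh⟩ := ih hl.2
    obtain ⟨E, F, N, htriple⟩ := exists_isRootTriple K t lowerEnd_ne_zero
      (b := (i : ℤ)) (by omega) (abs_lowerEnd_le hl.1.1 hl.1.2) (by rw [abs_le]; omega)
      (lowerEnd_lt hl.1.1).ne
    rw [List.map_cons, List.prod_cons, simpleReflection_eq]
    exact ⟨N 1 * h, mul_mem_representatives (prod_word_mem hl.2) (htriple.rep 1 one_ne_zero) hh⟩

lemma exists_polynomial_eval {σ : Type*} (P : σ → Polynomial K) (F : MvPolynomial σ K) :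
    ∃ Q : Polynomial K, ∀ c, MvPolynomial.eval (fun p => (P p).eval c) F = Q.eval c := by
  refine ⟨MvPolynomial.aeval P F, fun c => ?_⟩
  induction F using MvPolynomial.induction_on with
  | C a => simp
  | add p q hp hq => rw [map_add, map_add, Polynomial.eval_add, hp, hq]
  | mul_X p i hp => rw [map_mul, map_mul, Polynomial.eval_mul, hp]; simp

/-- The limit at `0` of a polynomial curve lies in every closed set containing the other points
of the curve. -/
lemma mem_of_polynomial_curve [IsAlgClosed K] {Z : Set (algGroup K t n)}
    (hZ : IsClosed[zariskiTopology K t n] Z) (φ : K → algGroup K t n)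
    (hφ : ∀ a b, ∃ P : Polynomial K, ∀ c, entry (φ c) a b = P.eval c)
    (h : ∀ c, c ≠ 0 → φ c ∈ Z) : φ 0 ∈ Z := by
  obtain ⟨S, rfl⟩ := isClosed_zariski_iff.1 hZ
  choose P hP using hφ
  intro F hF
  obtain ⟨Q, hQ⟩ := exists_polynomial_eval (fun p : Idx t n × Idx t n => P p.1 p.2) F
  have hQ' : ∀ c, MvPolynomial.eval (fun p => entry (φ c) p.1 p.2) F = Q.eval c := by
    intro c
    rw [← hQ c]
    simp only [hP]
  have hzero : Q = 0 := by
    refine Polynomial.eq_zero_of_infinite_isRoot Q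
      ((Set.finite_singleton (0 : K)).infinite_compl.mono fun c hc => ?_)
    change Q.eval c = 0
    rw [← hQ' c]
    exact h c hc F hF
  rw [hQ' 0, hzero, Polynomial.eval_zero]

/-- A point `y g` of the cell of `u` is the value at `c = 0` of the curve `y F(c) g`. For `c ≠ 0`,
writing `F(c) = E(c⁻¹) N(c) E(c⁻¹)`, the left factor is absorbed by `B` and the right one, moved
past `g`, by `P_r`. The curve therefore stays in the cell of the reflected element. -/
lemma schubertVariety_subset_of_lt [IsAlgClosed K] {r : ℕ} {u : Equiv.Perm ℤ}
    (hu : u ∈ weylGroup n) {a b : ℤ} (ha : a ≠ 0) (hb : b ≠ 0) (ha' : |a| ≤ n) (hb' : |b| ≤ n)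
    (hab : a < b) (hlt : u⁻¹ a < u⁻¹ b) :
    schubertVariety K t n r u ⊆ schubertVariety K t n r (signedSwap a b * u) := by
  obtain ⟨E, F, N, ht⟩ := exists_isRootTriple K t ha hb ha' hb' hab.ne
  let _ := flagTopology K t n r
  refine closure_minimal ?_ isClosed_closure
  rintro x ⟨y, hy, g, hg, rfl⟩
  have hZ : IsClosed[zariskiTopology K t n]
      ((QuotientGroup.mk : algGroup K t n → algGroup K t n ⧸ parabolic K t n r) ⁻¹'
        schubertVariety K t n r (signedSwap a b * u)) :=
    isClosed_coinduced.1 (isClosed_closure (X := algGroup K t n ⧸ parabolic K t n r))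
  have hcurve := mem_of_polynomial_curve hZ (fun c => y * (F c * g)) ?_ ?_
  · simpa [ht.zero] using hcurve
  · intro k l
    choose P hP using ht.poly
    refine ⟨∑ i, Polynomial.C (entry y k i) * ∑ j, P i j * Polynomial.C (entry g j l),
      fun c => ?_⟩
    simp only [entry_mul, hP, Polynomial.eval_finsetSum, Polynomial.eval_mul, Polynomial.eval_C]
  · intro c hc
    have hE : E c⁻¹ ∈ borel K t n := fun k l h => by
      simpa using ht.lower _ k l h 1 (one_mem _) (by simpa using hab)
    -- This is where `u⁻¹ a < u⁻¹ b` enters: `u⁻¹` carries the root of `E` to a root of `B`.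
    have hp : g⁻¹ * E c⁻¹ * g ∈ borel K t n := by
      intro k l h
      have h1 := entry_representative_mul hu hg (g⁻¹ * E c⁻¹ * g) k l
      rw [show g * (g⁻¹ * E c⁻¹ * g) = E c⁻¹ * g by group, entry_mul_representative hu hg] at h1
      have h2 : entry (E c⁻¹) (k.act hu) (l.act hu) ≠ 0 := by
        intro h3
        rw [h3, zero_mul, eq_comm, mul_eq_zero] at h1
        rcases h1 with h1 | h1
        · exact (hg _ k).2 (Idx.coe_act hu k) h1
        · exact h h1
      simpa using ht.lower _ _ _ h2 u⁻¹ (inv_mem hu) hlt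
    have hmk : (QuotientGroup.mk (y * (F c * g)) : algGroup K t n ⧸ parabolic K t n r) =
        QuotientGroup.mk ((y * E c⁻¹) * (N c * g)) := by
      rw [ht.eq c hc, show y * (E c⁻¹ * N c * E c⁻¹ * g) =
        ((y * E c⁻¹) * (N c * g)) * (g⁻¹ * E c⁻¹ * g) by group]
      exact QuotientGroup.mk_mul_of_mem _ (Subgroup.subset_closure (Or.inl hp))
    change (QuotientGroup.mk (y * (F c * g)) : algGroup K t n ⧸ parabolic K t n r) ∈
      schubertVariety K t n r (signedSwap a b * u)
    rw [hmk]
    exact subset_closure ⟨_, mul_mem_borel hy hE, _, mul_mem_representatives hu (ht.rep c hc) hg,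
      rfl⟩

lemma mem_of_bruhatLE {v w : Equiv.Perm ℤ} (hv : v ∈ weylGroup n) (h : BruhatLE n v w) :
    w ∈ weylGroup n := by
  induction h with
  | refl => exact hv
  | tail _ h ih =>
    obtain ⟨τ, hτ, rfl, _⟩ := h
    obtain ⟨g, hg, i, h1, h2, rfl⟩ := hτ
    exact mul_mem (mul_mem (mul_mem hg (simpleReflection_mem h1 h2)) (inv_mem hg)) ih

lemma schubertVariety_subset [IsAlgClosed K] {r : ℕ} {v w : Equiv.Perm ℤ}
    (hv : v ∈ weylGroup n) (h : BruhatLE n v w) :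
    schubertVariety K t n r v ⊆ schubertVariety K t n r w := by
  induction h with
  | refl => exact subset_rfl
  | tail hle h ih =>
    obtain ⟨τ, hτ, rfl, hlt⟩ := h
    have hu := mem_of_bruhatLE hv hle
    obtain ⟨a, b, ha, hb, ha', hb', hab, rfl, h⟩ := exists_of_bruhat_step hu hτ hlt
    exact ih.trans (schubertVariety_subset_of_lt hu ha hb ha' hb' hab h)

theorem richardsonVariety_nonempty_of_bruhatLE [IsAlgClosed K] {r : ℕ} {v w : Equiv.Perm ℤ}
    (hv : v ∈ weylGroup n) (h : BruhatLE n v w) : (richardsonVariety K t n r v w).Nonempty := by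
  obtain ⟨g, hg⟩ := representatives_nonempty (K := K) (t := t) hv
  let _ := flagTopology K t n r
  refine ⟨QuotientGroup.mk g, schubertVariety_subset hv h ?_, ?_⟩
  · exact subset_closure ⟨1, one_mem_borel, g, hg, by rw [one_mul]⟩
  · exact subset_closure ⟨1, one_mem_oppBorel, g, hg, by rw [one_mul]⟩

/-- For a minimal coset representative `v`, the Richardson variety is nonempty if and only if
the sets of values are in Gale order, if and only if the elements are in Bruhat order. -/
theorem nonempty_and_bruhatLE_iff_galeLE (K : Type*) [Field K] [IsAlgClosed K] (t : DynkinType)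
    {r : ℕ} (hr : 1 ≤ r) {v w : Equiv.Perm ℤ} (hv : v ∈ weylGroup n) (hw : w ∈ weylGroup n)
    (hv' : ∀ i, 1 ≤ i → i ≤ n → i ≠ r → IsAscent v i) :
    ((richardsonVariety K t n r v w).Nonempty ↔ GaleLE (values r n w) (values r n v)) ∧
    (BruhatLE n v w ↔ GaleLE (values r n w) (values r n v)) :=
  ⟨⟨galeLE_of_richardsonVariety_nonempty hr, fun h => richardsonVariety_nonempty_of_bruhatLE hv
      (bruhatLE_of_galeLE hr hv hw hv' h)⟩,
    -- The implication from Bruhat to Gale is obtained geometrically, through a point of the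
    -- Richardson variety.
    ⟨fun h => galeLE_of_richardsonVariety_nonempty (K := K) (t := t) hr
      (richardsonVariety_nonempty_of_bruhatLE hv h), bruhatLE_of_galeLE hr hv hw hv'⟩⟩

/-! ### Weights -/

lemma ε_neg (k : ℤ) : ε (-k) = -ε k := by
  funext a
  simp [ε]

lemma act_ε {w : Equiv.Perm ℤ} (hw : w ∈ weylGroup n) (k : ℤ) : act w (ε k) = ε (w k) := by
  funext a
  simp only [act, ε, Equiv.Perm.inv_eq_iff_eq, map_neg_of_mem hw]

/-- The action of a permutation on weights, as a linear map. -/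
def actLinear (w : Equiv.Perm ℤ) : (ℤ → ℝ) →ₗ[ℝ] (ℤ → ℝ) where
  toFun := act w
  map_add' _ _ := rfl
  map_smul' _ _ := rfl

lemma act_eq_actLinear (w : Equiv.Perm ℤ) (x : ℤ → ℝ) : act w x = actLinear w x := rfl

lemma oddPart_eq : oddPart t = ε 1 := by
  cases t with
  | B => simp [oddPart, simpleRoot]
  | C => simp [oddPart, simpleRoot, smul_smul]

/-- Up to a positive factor the simple roots of both types have one uniform shape; for `i = 1` it is
`2 ε_1`. -/
lemma exists_smul_simpleRoot (t : DynkinType) (i : ℕ) :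
    ∃ c : ℝ, 0 < c ∧ ε i - ε (lowerEnd i) = c • simpleRoot t i := by
  unfold simpleRoot lowerEnd
  by_cases h : i = 1
  · subst h
    cases t with
    | B => exact ⟨2, two_pos, by simp [ε_neg, two_smul]⟩
    | C => exact ⟨1, one_pos, by simp [ε_neg, two_smul]⟩
  · exact ⟨1, one_pos, by simp [h]⟩

/-- The sum of the coordinates from `k` to `n`, which is nonnegative on the positive cone. -/
def upperSum (n : ℕ) (k : ℤ) : (ℤ → ℝ) →ₗ[ℝ] ℝ where
  toFun x := ∑ a ∈ Finset.Icc k n, x a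
  map_add' x y := by simp [Finset.sum_add_distrib]
  map_smul' c x := by simp [Finset.mul_sum]

lemma upperSum_ε {k x : ℤ} (hx : |x| ≤ n) :
    upperSum n k (ε x) = (if k ≤ x then 1 else 0) - if k ≤ -x then 1 else 0 := by
  rw [abs_le] at hx
  change ∑ a ∈ Finset.Icc k n, ε x a = _
  simp only [ε, Finset.sum_sub_distrib, Finset.sum_ite_eq', Finset.mem_Icc]
  congr 1 <;> (split_ifs <;> first | rfl | omega)

lemma upperSum_simpleRoot_nonneg {k : ℤ} (hk : 1 ≤ k) {i : ℕ} (hi : 1 ≤ i) (hin : i ≤ n) :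
    0 ≤ upperSum n k (simpleRoot t i) := by
  obtain ⟨c, hc, h⟩ := exists_smul_simpleRoot t i
  have h1 : 0 ≤ upperSum n k (ε i - ε (lowerEnd i)) := by
    rw [map_sub, upperSum_ε (abs_lowerEnd_le hi hin), upperSum_ε (by rw [abs_le]; omega)]
    unfold lowerEnd
    split_ifs <;> first | omega | norm_num
  rw [h, map_smul, smul_eq_mul] at h1
  exact nonneg_of_mul_nonneg_right h1 hc

lemma upperSum_nonneg {x : ℤ → ℝ} (h : Nonneg t n x) {k : ℤ} (hk : 1 ≤ k) :
    0 ≤ upperSum n k x := by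
  obtain ⟨c, hc, rfl⟩ := h
  rw [map_sum]
  refine Finset.sum_nonneg fun i hi => ?_
  rw [Finset.mem_Icc] at hi
  rw [map_smul, smul_eq_mul]
  exact mul_nonneg (hc i) (upperSum_simpleRoot_nonneg hk hi.1 hi.2)

/-- At a descent, `w(α_i)` would be negative under one of the functionals `upperSum`, namely the one
starting at `-w i` or at `w (lowerEnd i)` according to the sign of the latter value. -/
lemma isAscent_of_mem_minimalReps {r : ℕ} {w : Equiv.Perm ℤ} (hw : w ∈ minimalReps t n r) (i : ℕ)
    (h1 : 1 ≤ i) (h2 : i ≤ n) (h3 : i ≠ r) : IsAscent w i := by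
  obtain ⟨hw, h⟩ := hw
  have hpos := (h i h1 h2 h3).2
  obtain ⟨c, hc, hroot⟩ := exists_smul_simpleRoot t i
  have hx := abs_map_le_of_mem hw (a := (i : ℤ)) (by rw [abs_le]; omega)
  have hy := abs_map_le_of_mem hw (abs_lowerEnd_le h1 h2)
  have key : ∀ k : ℤ, 1 ≤ k → 0 ≤ upperSum n k (ε (w i)) - upperSum n k (ε (w (lowerEnd i))) := by
    intro k hk
    rw [← map_sub, ← act_ε hw, ← act_ε hw, act_eq_actLinear, act_eq_actLinear, ← map_sub, hroot,
      map_smul, map_smul, smul_eq_mul]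
    exact mul_nonneg hc.le (upperSum_nonneg hpos hk)
  have hx0 := map_ne_zero_of_mem hw (a := (i : ℤ)) (by omega)
  have hy0 := map_ne_zero_of_mem hw (lowerEnd_ne_zero (i := i))
  have hne : w (lowerEnd i) ≠ w i := fun h' => (lowerEnd_lt h1).ne (w.injective h')
  unfold IsAscent
  by_contra hlt
  rcases lt_or_gt_of_ne hy0 with hy1 | hy1
  · have := key (-w i) (by omega)
    rw [upperSum_ε hx, upperSum_ε hy] at this
    split_ifs at this <;> first | omega | norm_num at this
  · have := key (w (lowerEnd i)) (by omega)
    rw [upperSum_ε hx, upperSum_ε hy] at this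
    split_ifs at this <;> first | omega | norm_num at this

/-- The factor `c` absorbs the `1 / 2` of the spin weight `ω_1` in type `B`; being positive, it does
not affect signs. -/
lemma exists_act_fundamentalWeight (t : DynkinType) (r : ℕ) {w : Equiv.Perm ℤ}
    (hw : w ∈ weylGroup n) : ∃ c : ℝ, 0 < c ∧ (2 ≤ r → c = 1) ∧
      act w (fundamentalWeight t n r) = c • ∑ x ∈ values r n w, ε x := by
  have h : actLinear w (∑ k ∈ Finset.Icc r n, ε k) = ∑ x ∈ values r n w, ε x := by
    rw [map_sum, sum_values]
    exact Finset.sum_congr rfl fun k _ => act_ε hw k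
  cases t with
  | B =>
    refine ⟨if r = 1 then 1 / 2 else 1, by split_ifs <;> norm_num,
      fun h => if_neg (by omega), ?_⟩
    rw [act_eq_actLinear, fundamentalWeight, map_smul, h]
  | C => exact ⟨1, one_pos, fun _ => rfl, by rw [act_eq_actLinear, fundamentalWeight, h, one_smul]⟩

lemma sum_ε_apply (S : Finset ℤ) (a : ℤ) :
    (∑ x ∈ S, ε x) a = (if a ∈ S then 1 else 0) - if -a ∈ S then 1 else 0 := by
  rw [Finset.sum_apply]
  simp only [ε, Finset.sum_sub_distrib, Finset.sum_ite_eq]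
  congr 1
  rw [← Finset.sum_ite_eq S (-a) fun _ => (1 : ℝ)]
  exact Finset.sum_congr rfl fun x _ => by congr 1; rw [eq_iff_iff]; omega

lemma subset_of_sum_ε_eq {S T : Finset ℤ} (hS : ∀ x ∈ S, -x ∉ S)
    (h : ∑ x ∈ S, ε x = ∑ x ∈ T, ε x) : S ⊆ T := by
  intro a ha
  have := congrFun h a
  rw [sum_ε_apply, sum_ε_apply, if_pos ha, if_neg (hS a ha)] at this
  by_contra hT
  rw [if_neg hT] at this
  split_ifs at this <;> norm_num at this

/-- The weight `w(ω_r)` determines the set of values of `w`. -/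
lemma upCount_values_of_act_eq {r : ℕ} (hr : 2 ≤ r) {w : Equiv.Perm ℤ} (hw : w ∈ weylGroup n)
    {ι : Type*} [Fintype ι] {f : ι → ℤ} (hf : Function.Injective f)
    (hf' : ∀ x y, f x ≠ -f y) (h : act w (fundamentalWeight t n r) = ∑ x, ε (f x)) (c : ℤ) :
    upCount (values r n w) c = ∑ x, if c ≤ f x then 1 else 0 := by
  obtain ⟨d, _, hd, hact⟩ := exists_act_fundamentalWeight t r hw
  rw [hd hr, one_smul, h, ← Finset.sum_image (g := f) (f := ε) (s := Finset.univ)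
    fun x _ y _ h => hf h] at hact
  have heq : Finset.univ.image f = values r n w := by
    refine (subset_of_sum_ε_eq ?_ hact).antisymm (subset_of_sum_ε_eq ?_ hact.symm)
    · intro x hx hx'
      obtain ⟨y, _, rfl⟩ := Finset.mem_image.1 hx
      obtain ⟨z, _, hz⟩ := Finset.mem_image.1 hx'
      exact hf' z y hz
    · exact fun x hx => (admissible_values (by omega) hw x hx).2
  rw [← heq, upCount, Finset.sum_image fun x _ y _ h => hf h]

/-! ### Sums of pairwise orthogonal simple roots. -/

lemma J_strictMono {m s : ℕ} {i : Fin m → ℕ} (hi : i ∈ J m s n) {k l : Fin m} (h : k < l) :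
    i k + 2 ≤ i l := by
  have key : ∀ d : ℕ, ∀ k l : Fin m, (l : ℕ) = k + d + 1 → i k + 2 ≤ i l := by
    intro d
    induction d with
    | zero => exact fun k l h => hi.2 k l h
    | succ d ih =>
      intro k l h
      have hd : (k : ℕ) + d + 1 < m := by omega
      have h1 := ih k ⟨_, hd⟩ rfl
      have h2 := hi.2 ⟨_, hd⟩ l (by simpa [add_assoc] using h)
      omega
  exact key (l - k - 1) k l (by have : (k : ℕ) < l := h; omega)

/-- The Gale order for the weights that are sums of pairwise orthogonal simple roots, and the
negatives of such sums. -/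
lemma forall_sum_le_iff {m e : ℕ} {i j : Fin m → ℕ} (hi : i ∈ J m (2 + e) n)
    (hj : j ∈ J m (2 + e) n) (he : e ≤ 1) :
    (∀ c : ℤ, (∑ k, if c ≤ -(j k : ℤ) then (1 : ℤ) else 0) +
        ((∑ k, if c ≤ (j k : ℤ) - 1 then 1 else 0) + ∑ _k : Fin e, if c ≤ -1 then 1 else 0) ≤
      (∑ k, if c ≤ (i k : ℤ) then 1 else 0) +
        ((∑ k, if c ≤ -((i k : ℤ) - 1) then 1 else 0) + ∑ _k : Fin e, if c ≤ 1 then 1 else 0)) ↔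
    ∀ k, |(i k : ℤ) - (j k : ℤ)| ≤ 1 := by
  constructor
  · intro h k
    have hjk := (hj.1 k).1
    rw [abs_le]
    constructor
    · by_contra hlt
      -- Here `i_k < j_k - 1`. At this `c`, which exceeds `1` if `e = 1`, only `j_l - 1` and `i_l`
      -- can count; every `l ≥ k` counts for `w`, only `l > k` for `v`.
      have hc := h ((j k : ℤ) - 1)
      rw [Finset.sum_eq_zero (fun l _ => if_neg (by omega)),
        Finset.sum_eq_zero (s := (Finset.univ : Finset (Fin e))) (fun l _ => if_neg (by omega)),
        Finset.sum_eq_zero (f := fun l => if (j k : ℤ) - 1 ≤ -((i l : ℤ) - 1) then (1 : ℤ) else 0)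
          (fun l _ => if_neg (by have := (hi.1 l).1; omega)),
        Finset.sum_eq_zero (s := (Finset.univ : Finset (Fin e)))
          (f := fun _ => if (j k : ℤ) - 1 ≤ 1 then (1 : ℤ) else 0)
          (fun l _ => if_neg (by have := l.2; omega))] at hc
      have hlt' : (∑ l, if (j k : ℤ) - 1 ≤ (i l : ℤ) then (1 : ℤ) else 0) <
          ∑ l, if (j k : ℤ) - 1 ≤ (j l : ℤ) - 1 then 1 else 0 := by
        refine Finset.sum_lt_sum (fun l _ => ?_) ⟨k, Finset.mem_univ _, ?_⟩
        · rcases lt_trichotomy k l with hkl | rfl | hkl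
          · have := J_strictMono hj hkl
            split_ifs <;> omega
          · split_ifs <;> omega
          · have := J_strictMono hi hkl
            split_ifs <;> omega
        · rw [if_neg (by omega), if_pos le_rfl]
          exact one_pos
      omega
    · by_contra hlt
      -- Here `i_k - 1 > j_k`. All positive values and `±1` are counted on both sides and cancel; of
      -- the rest, every `l ≤ k` counts for `w`, only `l < k` for `v`.
      have hc := h (-(j k : ℤ))
      have e1 : ∀ l : Fin m, -(j k : ℤ) ≤ (j l : ℤ) - 1 := fun l => by
        have := (hj.1 l).1; omega
      have e2 : ∀ l : Fin m, -(j k : ℤ) ≤ (i l : ℤ) := fun l => by omega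
      have e3 : -(j k : ℤ) ≤ -1 := by omega
      have e4 : -(j k : ℤ) ≤ 1 := by omega
      simp only [e1, e2, e3, e4, if_true] at hc
      have hlt' : (∑ l, if -(j k : ℤ) ≤ -((i l : ℤ) - 1) then (1 : ℤ) else 0) <
          ∑ l, if -(j k : ℤ) ≤ -(j l : ℤ) then 1 else 0 := by
        refine Finset.sum_lt_sum (fun l _ => ?_) ⟨k, Finset.mem_univ _, ?_⟩
        · rcases lt_trichotomy k l with hkl | rfl | hkl
          · have := J_strictMono hi hkl
            split_ifs <;> omega
          · split_ifs <;> omega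
          · have := J_strictMono hj hkl
            split_ifs <;> omega
        · rw [if_neg (by omega), if_pos le_rfl]
          exact one_pos
      omega
  -- The values are matched as `-j_k ≤ -(i_k - 1)`, `j_k - 1 ≤ i_k` and `-1 ≤ 1`.
  · intro h c
    have h1 : (∑ k, if c ≤ -(j k : ℤ) then (1 : ℤ) else 0) ≤
        ∑ k, if c ≤ -((i k : ℤ) - 1) then 1 else 0 := by
      refine Finset.sum_le_sum fun k _ => ?_
      have := abs_le.1 (h k)
      split_ifs <;> omega
    have h2 : (∑ k, if c ≤ (j k : ℤ) - 1 then (1 : ℤ) else 0) ≤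
        ∑ k, if c ≤ (i k : ℤ) then 1 else 0 := by
      refine Finset.sum_le_sum fun k _ => ?_
      have := abs_le.1 (h k)
      split_ifs <;> omega
    have h3 : (∑ _k : Fin e, if c ≤ -1 then (1 : ℤ) else 0) ≤
        ∑ _k : Fin e, if c ≤ 1 then 1 else 0 := by
      refine Finset.sum_le_sum fun k _ => ?_
      split_ifs <;> omega
    omega

lemma simpleRoot_of_two_le (t : DynkinType) {i : ℕ} (hi : 2 ≤ i) :
    simpleRoot t i = ε i + ε (-((i : ℤ) - 1)) := by
  unfold simpleRoot
  rw [if_neg (by omega), ε_neg, sub_eq_add_neg]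

/-- The values `i_k`, `-(i_k - 1)` and, if `e = 1`, `1`. -/
def rootValues (e : ℕ) {m : ℕ} (i : Fin m → ℕ) : Fin m ⊕ (Fin m ⊕ Fin e) → ℤ :=
  Sum.elim (fun k => (i k : ℤ)) (Sum.elim (fun k => -((i k : ℤ) - 1)) fun _ => 1)

lemma J_ne {m s : ℕ} {i : Fin m → ℕ} (hi : i ∈ J m s n) {k l : Fin m} (h : k ≠ l) :
    i k + 2 ≤ i l ∨ i l + 2 ≤ i k :=
  (lt_or_gt_of_ne h).imp (J_strictMono hi) (J_strictMono hi)

lemma rootValues_injective {m e : ℕ} (he : e ≤ 1) {i : Fin m → ℕ} (hi : i ∈ J m (2 + e) n) :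
    Function.Injective (rootValues e i) := by
  have h2 := fun k => (hi.1 k).1
  rintro (k | k | k) (l | l | l) h <;> simp only [rootValues, Sum.elim_inl, Sum.elim_inr] at h
  · by_cases hkl : k = l
    · rw [hkl]
    · have := J_ne hi hkl; omega
  · have := h2 k; have := h2 l; omega
  · have := h2 k; omega
  · have := h2 k; have := h2 l; omega
  · by_cases hkl : k = l
    · rw [hkl]
    · have := J_ne hi hkl; omega
  · have := h2 k; omega
  · have := h2 l; omega
  · have := h2 l; omega
  · rw [show k = l from Fin.ext (by omega)]

/-- The gaps of `2` exclude `i_k = i_l - 1`, and for `e = 1` the start at `3` excludes `i_k - 1 =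
1`. -/
lemma rootValues_ne_neg {m e : ℕ} {i : Fin m → ℕ} (hi : i ∈ J m (2 + e) n)
    (x y : Fin m ⊕ (Fin m ⊕ Fin e)) : rootValues e i x ≠ -rootValues e i y := by
  have h2 := fun k => (hi.1 k).1
  intro h
  rcases x with k | k | k <;> rcases y with l | l | l <;>
    simp only [rootValues, Sum.elim_inl, Sum.elim_inr] at h
  · have := h2 k; omega
  · by_cases hkl : k = l
    · subst hkl; omega
    · have := J_ne hi hkl; omega
  · omega
  · by_cases hkl : k = l
    · subst hkl; omega
    · have := J_ne hi hkl; omega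
  · have := h2 k; have := h2 l; omega
  · have := h2 k; have := l.2; omega
  · omega
  · have := h2 l; have := k.2; omega
  · omega

lemma sum_ε_rootValues (t : DynkinType) {m e : ℕ} {i : Fin m → ℕ} (hi : i ∈ J m (2 + e) n) :
    ∑ x, ε (rootValues e i x) = e • oddPart t + ∑ k, simpleRoot t (i k) := by
  have h : ∀ k, simpleRoot t (i k) = ε (i k) + ε (-((i k : ℤ) - 1)) := fun k =>
    simpleRoot_of_two_le t (by have := (hi.1 k).1; omega)
  simp only [rootValues, Fintype.sum_sum_type, Sum.elim_inl, Sum.elim_inr, h, oddPart_eq,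
    Finset.sum_add_distrib, Finset.sum_const, Finset.card_univ, Fintype.card_fin]
  abel

lemma galeLE_values_iff {r m e : ℕ} (hr : 2 ≤ r) (he : e ≤ 1) {i j : Fin m → ℕ}
    (hi : i ∈ J m (2 + e) n) (hj : j ∈ J m (2 + e) n) {v w : Equiv.Perm ℤ}
    (hv : v ∈ weylGroup n) (hw : w ∈ weylGroup n)
    (hvω : act v (fundamentalWeight t n r) = e • oddPart t + ∑ k, simpleRoot t (i k))
    (hwω : act w (fundamentalWeight t n r) = -(e • oddPart t + ∑ k, simpleRoot t (j k))) :
    GaleLE (values r n w) (values r n v) ↔ ∀ k, |(i k : ℤ) - (j k : ℤ)| ≤ 1 := by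
  rw [← forall_sum_le_iff hi hj he]
  rw [← sum_ε_rootValues t hi] at hvω
  rw [← sum_ε_rootValues t hj, ← Finset.sum_neg_distrib] at hwω
  simp only [← ε_neg] at hwω
  have ev := upCount_values_of_act_eq hr hv (rootValues_injective he hi) (rootValues_ne_neg hi) hvω
  have ew := upCount_values_of_act_eq hr hw (f := fun x => -rootValues e j x)
    (neg_injective.comp (rootValues_injective he hj))
    (fun x y h => rootValues_ne_neg hj x y (by simpa using congrArg Neg.neg h)) hwω
  refine forall_congr' fun c => ?_
  rw [ev, ew]
  simp only [Fintype.sum_sum_type, rootValues, Sum.elim_inl, Sum.elim_inr, neg_sub]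
  exact Iff.rfl

/-! ### The extremal fundamental weights -/

lemma upperSum_sum_ε {r : ℕ} {w : Equiv.Perm ℤ} (hr : 1 ≤ r) (hw : w ∈ weylGroup n) (k : ℤ) :
    upperSum n k (∑ x ∈ values r n w, ε x) =
      ((upCount (values r n w) k - ∑ x ∈ values r n w, if k ≤ -x then 1 else 0 : ℤ) : ℝ) := by
  rw [map_sum, upCount, ← Finset.sum_sub_distrib, Int.cast_sum]
  refine Finset.sum_congr rfl fun x hx => ?_
  rw [upperSum_ε (admissible_values hr hw x hx).1]
  push_cast
  rfl

lemma le_upCount_of_nonneg {r : ℕ} (hr : 1 ≤ r) {v : Equiv.Perm ℤ} (hv : v ∈ weylGroup n)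
    (h : Nonneg t n (act v (fundamentalWeight t n r))) {k : ℤ} (hk : 1 ≤ k) :
    (∑ x ∈ values r n v, if k ≤ -x then (1 : ℤ) else 0) ≤ upCount (values r n v) k := by
  obtain ⟨c, hc, _, hact⟩ := exists_act_fundamentalWeight t r hv
  have h1 := upperSum_nonneg h hk
  rw [hact, map_smul, smul_eq_mul, upperSum_sum_ε hr hv] at h1
  have h2 := nonneg_of_mul_nonneg_right h1 hc
  rw [Int.cast_nonneg_iff] at h2
  omega

lemma upCount_le_of_nonpos {r : ℕ} (hr : 1 ≤ r) {w : Equiv.Perm ℤ} (hw : w ∈ weylGroup n)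
    (h : Nonneg t n (-act w (fundamentalWeight t n r))) {k : ℤ} (hk : 1 ≤ k) :
    upCount (values r n w) k ≤ ∑ x ∈ values r n w, if k ≤ -x then (1 : ℤ) else 0 := by
  obtain ⟨c, hc, _, hact⟩ := exists_act_fundamentalWeight t r hw
  have h1 := upperSum_nonneg h hk
  rw [hact, ← smul_neg, map_smul, smul_eq_mul, map_neg, upperSum_sum_ε hr hw] at h1
  have h2 := nonneg_of_mul_nonneg_right h1 hc
  rw [← Int.cast_neg, Int.cast_nonneg_iff] at h2
  omega

/-- For `r = 1` the values and their opposites partition the nonzero elements of `[-n, n]`, so the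
total does not depend on `w`. -/
lemma sum_values_add_sum_neg {w : Equiv.Perm ℤ} (hw : w ∈ weylGroup n) (g : ℤ → ℤ) :
    ∑ x ∈ values 1 n w, g x + ∑ x ∈ values 1 n w, g (-x) =
      ∑ x ∈ (Finset.Icc (-(n : ℤ)) n).erase 0, g x := by
  rw [← Finset.sum_image (s := values 1 n w) (g := fun x => -x) (f := g)
    fun x _ y _ h => neg_injective h, ← Finset.sum_union]
  · refine Finset.sum_congr (Finset.ext fun x => ?_) fun _ _ => rfl
    have hneg : x ∈ (values 1 n w).image (fun x => -x) ↔ -x ∈ values 1 n w := by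
      rw [Finset.mem_image]
      exact ⟨by rintro ⟨y, hy, rfl⟩; simpa using hy, fun h => ⟨-x, h, neg_neg x⟩⟩
    rw [Finset.mem_union, hneg, mem_values, mem_values, map_neg_of_mem (inv_mem hw),
      Finset.mem_erase, Finset.mem_Icc]
    have h0 : x = 0 ↔ w⁻¹ x = 0 :=
      ⟨fun h => by rw [h, map_zero_of_mem (inv_mem hw)], fun h => by
        by_contra hx; exact map_ne_zero_of_mem (inv_mem hw) hx h⟩
    have h1 : |x| ≤ n ↔ |w⁻¹ x| ≤ n :=
      ⟨abs_map_le_of_mem (inv_mem hw), fun h => by simpa using abs_map_le_of_mem hw h⟩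
    rw [abs_le, abs_le] at h1
    rw [ne_eq, h0, h1]
    push_cast
    omega
  · rw [Finset.disjoint_left]
    intro x hx hx'
    obtain ⟨y, hy, rfl⟩ := Finset.mem_image.1 hx'
    exact (admissible_values le_rfl hw y hy).2 hx

lemma upCount_add_sum (S : Finset ℤ) (c : ℤ) :
    upCount S c + ∑ x ∈ S, (if 1 - c ≤ -x then (1 : ℤ) else 0) = S.card := by
  rw [upCount, ← Finset.sum_add_distrib, Finset.card_eq_sum_ones, Nat.cast_sum]
  refine Finset.sum_congr rfl fun x _ => ?_
  push_cast
  split_ifs <;> omega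

/-- Nonnegativity gives `v` at least as many values `≥ k` as `≤ -k`, and `w` at most as many. For `r
= 1` the two numbers have the same sum for `v` and `w`, and for `r = n` there is a single nonzero
value, so `v` wins either way. Passing to complements gives the inequalities with `c ≤ 0`. -/
lemma galeLE_of_nonneg_of_nonpos {r : ℕ} (hn : 1 ≤ n) (hr : r = 1 ∨ r = n) {v w : Equiv.Perm ℤ}
    (hv : v ∈ weylGroup n) (hw : w ∈ weylGroup n)
    (hv' : Nonneg t n (act v (fundamentalWeight t n r)))
    (hw' : Nonneg t n (-act w (fundamentalWeight t n r))) :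
    GaleLE (values r n w) (values r n v) := by
  have hr1 : 1 ≤ r := by omega
  have key : ∀ k : ℤ, 1 ≤ k → upCount (values r n w) k ≤ upCount (values r n v) k ∧
      (∑ x ∈ values r n v, if k ≤ -x then (1 : ℤ) else 0) ≤
        ∑ x ∈ values r n w, if k ≤ -x then (1 : ℤ) else 0 := by
    intro k hk
    have e1 := le_upCount_of_nonneg hr1 hv hv' hk
    have e2 := upCount_le_of_nonpos hr1 hw hw' hk
    rcases hr with rfl | rfl
    · have e3 := sum_values_add_sum_neg hv fun x => if k ≤ x then 1 else 0
      rw [← sum_values_add_sum_neg hw] at e3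
      unfold upCount at *
      omega
    · simp only [upCount, values, Finset.Icc_self, Finset.image_singleton,
        Finset.sum_singleton] at *
      split_ifs at * <;> omega
  intro c
  by_cases hc : 1 ≤ c
  · exact (key c hc).1
  · have e1 := upCount_add_sum (values r n v) c
    have e2 := upCount_add_sum (values r n w) c
    have e3 := (key (1 - c) (by omega)).2
    rw [card_values] at e1 e2
    omega

end RichardsonBC
end

open RichardsonBC
theorem proposition4p4 (K : Type*) [Field K] [IsAlgClosed K] (t : DynkinType) (n r : ℕ) :
    -- `2 ≤ r ≤ n - 1` and `n + 1 - r = 2m` is even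
    (2 ≤ r → r + 1 ≤ n → ∀ m : ℕ, n + 1 = r + 2 * m →
      ∀ i ∈ J m 2 n, ∀ j ∈ J m 2 n,
      ∀ v ∈ minimalReps t n r, ∀ w ∈ minimalReps t n r,
        act v (fundamentalWeight t n r) = ∑ k, simpleRoot t (i k) →
        act w (fundamentalWeight t n r) = -∑ k, simpleRoot t (j k) →
        ((richardsonVariety K t n r v w).Nonempty ↔ ∀ k, |(i k : ℤ) - (j k : ℤ)| ≤ 1) ∧
        (BruhatLE n v w ↔ ∀ k, |(i k : ℤ) - (j k : ℤ)| ≤ 1)) ∧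
    -- `2 ≤ r ≤ n - 1` and `n + 1 - r = 2m + 1` is odd
    (2 ≤ r → r + 1 ≤ n → ∀ m : ℕ, n + 1 = r + (2 * m + 1) →
      ∀ i ∈ J m 3 n, ∀ j ∈ J m 3 n,
      ∀ v ∈ minimalReps t n r, ∀ w ∈ minimalReps t n r,
        act v (fundamentalWeight t n r) = oddPart t + ∑ k, simpleRoot t (i k) →
        act w (fundamentalWeight t n r) = -(oddPart t + ∑ k, simpleRoot t (j k)) →
        ((richardsonVariety K t n r v w).Nonempty ↔ ∀ k, |(i k : ℤ) - (j k : ℤ)| ≤ 1) ∧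
        (BruhatLE n v w ↔ ∀ k, |(i k : ℤ) - (j k : ℤ)| ≤ 1)) ∧
    -- `r = 1` or `r = n`
    (1 ≤ n → r = 1 ∨ r = n →
      ∀ v w : Equiv.Perm ℤ, IsMaximalNonneg t n r v → IsMinimalNonpos t n r w →
        (richardsonVariety K t n r v w).Nonempty ∧ BruhatLE n v w) := by
  refine ⟨fun hr _ m _ i hi j hj v hv w hw hvω hwω => ?_,
    fun hr _ m _ i hi j hj v hv w hw hvω hwω => ?_, fun hn hr v w hv hw => ?_⟩
  · have h := nonempty_and_bruhatLE_iff_galeLE K t (by omega) hv.1 hw.1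
      (isAscent_of_mem_minimalReps hv)
    rwa [galeLE_values_iff (t := t) (e := 0) hr zero_le_one hi hj hv.1 hw.1 (by simpa using hvω)
      (by simpa using hwω)] at h
  · have h := nonempty_and_bruhatLE_iff_galeLE K t (by omega) hv.1 hw.1
      (isAscent_of_mem_minimalReps hv)
    rwa [galeLE_values_iff (t := t) (e := 1) hr le_rfl hi hj hv.1 hw.1 (by simpa using hvω)
      (by simpa using hwω)] at h
  · have hgale := galeLE_of_nonneg_of_nonpos hn hr hv.1.1 hw.1.1 hv.2.1 hw.2.1
    have h := nonempty_and_bruhatLE_iff_galeLE K t (by omega) hv.1.1 hw.1.1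
      (isAscent_of_mem_minimalReps hv.1)
    exact ⟨h.1.2 hgale, h.2.2 hgale⟩
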